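/- **Setting.** Let $\mathcal C$ be a labeled continuous-time Markov chain with finite state set $S$, initial state $s_I$, transition matrix $\Delta\colon S\to\mathrm{Distr}(S)$, exit rates $E\colon S\to\mathbb R_{\ge 0}$ and labeling $L\colon S\to C$; let $\mathbb P_{\mathcal C}$ be its probability measure on timed paths $\pi$ (sequences of states and exponentially distributed residence times), $\pi(t)$ the state at time $t$, and $\Pr_s(t)(s')=\big(e^{(R-\mathrm{diag}(E))t}\big)_{s,s'}$ with $R(s,s')=\Delta(s)(s')E(s)$. Let $w\colon S\to\mathbb R_{\ge0}$. Let $\Omega=\langle\mathcal T_1,o_1\rangle,\dots,\langle\mathcal T_d,o_d\rangle$, $d\ge1$, be imprecise evidence: each $\mathcal T_i\subset\mathbb R_{>0}$ is a nonempty finite union of compact intervals, $o_i\in C$, and $\max\mathcal T_i<\min\mathcal T_{i+1}$. An instance $\rho\in\Omega$ is a choice of times $t_i\in\mathcal T_i$ ($i=1,\dots,d$); $\pi\models\rho$ means $L(\pi(t_i))=o_i$ for all $i$. Put (with $0/0=0$) $$W(\Omega)=\sup_{\rho\in\Omega}\sum_{s\in S}\mathbb P_{\mathcal C}\big(\pi(t_d)=s\mid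 \pi\models\rho\big)\,w(s).$$ **Conditioned MDP.** Let $\mathcal N=\{0\}\cup\bigcup_i\mathcal T_i\cup\{t_\star\}$, with an edge $t\to t'$ if it occurs in the path $0\to t_1\to\cdots\to t_d\to t_\star$ of some $\rho\in\Omega$. The MDP has states $S\times\mathcal N$, initial state $\langle s_I,0\rangle$, and in $\langle s,t\rangle$ the actions $t'$ with $t\to t'$. If $t\in\mathcal T_i$ and $L(s)\ne o_i$, every action leads to $\langle s_I,0\rangle$ with probability one. Otherwise action $t'$ leads to $\langle s',t'\rangle$ with probability $\Pr_s(t'-t)(s')$ if $t'\neq t_\star$, and to $\langle s,t_\star\rangle$ with probability one if $t'=t_\star$. The states $\langle s,t_\star\rangle$ are absorbing (single action $t_\star$). **Abstraction.** Let $\Psi$ be a time partition of $\Omega$: each $\mathcal T_i$ is covered by finitely many subsets with pairwise disjoint interiors, each $t\in\mathcal T_i$ is assigned to one subset $\Psi(t)\ni t$ of this cover, and $\Psi(0)=0$, $\Psi(t_\star)=t_\star$. The interval MDP $\mathcal I$ has states $\langle s,\Psi(t)\rangle$, initial state $\langle s_I,0\rangle$, in $\langle s,\psi\rangle$ the actions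 $\Psi(t')$ for actions $t'$ enabled in some $\langle s,t\rangle$ with $\Psi(t)=\psi$, and, for such $\psi,\psi'$ and each state $\langle s'',\psi''\rangle$, the interval $[\inf X,\sup X]$, where $X$ is the set of the probabilities with which action $t'$ in $\langle s,t\rangle$ leads into $\{\langle s'',t''\rangle:\Psi(t'')=\psi''\}$, over all $t,t'$ with $\Psi(t)=\psi$, $\Psi(t')=\psi'$ and $t'$ enabled in $\langle s,t\rangle$. Write $\tilde P\in\mathcal P$ if $\tilde P$ assigns to every state and enabled action a distribution over the states whose entries lie in these intervals. $\mathrm{Sched}_{\mathcal I}$ is the set of memoryless schedulers (each choosing an enabled action in every state); $\sigma$ is consistent, $\sigma\in\mathrm{Sched}_{\mathcal I}^{\mathsf{con}}$, if for some $\rho\in\Omega$ with times $t_1,\dots,t_d$ and all $s\in S$: $\sigma(\langle s,0\rangle)=\Psi(t_1)$, $\sigma(\langle s,\Psi(t_i)\rangle)=\Psi(t_{i+1})$ for $1\le i<d$, and $\sigma(\langle s,\Psi(t_d)\rangle)=t_\star$. Finally $W_{\mathcal I}(\tilde P,\sigma)=\sum_{s\in S}\mathbb P^{\sigma}_{\mathcal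 I[\tilde P]}(\lozenge\langle s,t_\star\rangle)\,w(s)$, where $\mathbb P^\sigma_{\mathcal I[\tilde P]}$ is the path measure of the Markov chain induced by $\tilde P$ and $\sigma$, and $\lozenge q$ is the event that $q$ is eventually visited. **Statement.** All maxima and minima below are attained, and $$W(\Omega)\le\max_{\sigma\in\mathrm{Sched}_{\mathcal I}^{\mathsf{con}}}\max_{\tilde P\in\mathcal P}W_{\mathcal I}(\tilde P,\sigma)\le\max_{\sigma\in\mathrm{Sched}_{\mathcal I}}\max_{\tilde P\in\mathcal P}W_{\mathcal I}(\tilde P,\sigma).$$ Moreover, for every consistent scheduler $\hat\sigma\in\mathrm{Sched}_{\mathcal I}^{\mathsf{con}}$, $\min_{\tilde P\in\mathcal P}W_{\mathcal I}(\tilde P,\hat\sigma)\le W(\Omega)$. -/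

import Mathlib

open MeasureTheory ProbabilityTheory
open scoped NNReal ENNReal

/-! ## Markov chains on a measurable state space -/

/-- The law on `ℕ → X` of the time-homogeneous Markov chain with transition kernel `κ` and initial
law `μ` (Ionescu-Tulcea). -/
noncomputable def chainMeasure {X : Type*} [MeasurableSpace X] (κ : Kernel X X) [IsMarkovKernel κ]
    (μ : Measure X) : Measure (ℕ → X) :=
  (μ.map (fun x (_ : Finset.Iic 0) => x)).bind
    (Kernel.traj (X := fun _ => X)
      (fun n => κ.comap (fun h : (Finset.Iic n → X) => h ⟨n, Finset.mem_Iic.2 le_rfl⟩)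
        (measurable_pi_apply _)) 0)

/-- The transition kernel of a Markov chain given by transition distributions, on a set of states
carrying the discrete σ-algebra. -/
noncomputable def discreteKernel {Q : Type*} (K : Q → PMF Q) : @Kernel Q Q ⊤ ⊤ :=
  letI : MeasurableSpace Q := ⊤
  { toFun := fun q => (K q).toMeasure
    measurable' := measurable_from_top }

instance {Q : Type*} (K : Q → PMF Q) : @IsMarkovKernel Q Q ⊤ ⊤ (discreteKernel K) :=
  letI : MeasurableSpace Q := ⊤
  ⟨fun q => PMF.toMeasure.isProbabilityMeasure (K q)⟩

/-- The probability that the Markov chain with transition distributions `K`, started in `q₀`,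
eventually visits the state `q`. -/
noncomputable def reachProb {Q : Type*} (K : Q → PMF Q) (q₀ q : Q) : ℝ≥0∞ :=
  letI : MeasurableSpace Q := ⊤
  chainMeasure (discreteKernel K) (Measure.dirac q₀) {ξ | ∃ k, ξ k = q}

/-! ## Labeled continuous-time Markov chains -/

/-- A labeled CTMC with states `S` and colors `C`: initial state, transition matrix, exit rates and
labeling. -/
structure CTMC (S C : Type*) where
  init : S
  jump : S → PMF S
  rate : S → ℝ≥0
  label : S → C

/-- The law of the residence time in a state with exit rate `r`: exponential with parameter `r`;
a state with exit rate `0` is never left. -/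
noncomputable def residenceLaw (r : ℝ≥0) : Measure ℝ≥0∞ :=
  if r = 0 then Measure.dirac ∞ else (expMeasure (r : ℝ)).map ENNReal.ofReal

instance (r : ℝ≥0) : IsProbabilityMeasure (residenceLaw r) := by
  unfold residenceLaw
  split_ifs with h
  · infer_instance
  · have : IsProbabilityMeasure (expMeasure (r : ℝ)) :=
      isProbabilityMeasure_expMeasure (NNReal.coe_pos.2 (pos_iff_ne_zero.2 h))
    exact Measure.isProbabilityMeasure_map ENNReal.measurable_ofReal.aemeasurable

namespace CTMC

variable {S C : Type*}

/-- The law of a pair (state, residence time in this state), for the fixed state `s`. -/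
noncomputable def entryLaw [MeasurableSpace S] (M : CTMC S C) (s : S) : Measure (S × ℝ≥0∞) :=
  (Measure.dirac s).prod (residenceLaw (M.rate s))

instance [MeasurableSpace S] (M : CTMC S C) (s : S) : IsProbabilityMeasure (M.entryLaw s) := by
  unfold entryLaw; infer_instance

/-- From a state `s` (whatever the residence time was), move to a state drawn from the transition
matrix and draw its residence time. -/
noncomputable def stepKernel [Fintype S] [MeasurableSpace S] [DiscreteMeasurableSpace S]
    (M : CTMC S C) : Kernel (S × ℝ≥0∞) (S × ℝ≥0∞) :=
  (Kernel.ofFunOfCountable fun s => (M.jump s).toMeasure.bind M.entryLaw).comap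
    Prod.fst measurable_fst

instance [Fintype S] [MeasurableSpace S] [DiscreteMeasurableSpace S] (M : CTMC S C) :
    IsMarkovKernel M.stepKernel := by
  refine ⟨fun x => ?_⟩
  have : M.stepKernel x = (M.jump x.1).toMeasure.bind M.entryLaw := rfl
  rw [this]
  exact isProbabilityMeasure_bind (Measurable.of_discrete).aemeasurable
    (Filter.Eventually.of_forall fun s => inferInstance)

/-- The probability measure on timed paths, i.e. on sequences of states and residence times. -/
noncomputable def pathMeasure [Fintype S] [MeasurableSpace S] [DiscreteMeasurableSpace S]
    (M : CTMC S C) : Measure (ℕ → S × ℝ≥0∞) :=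
  chainMeasure M.stepKernel (M.entryLaw M.init)

open Classical in
/-- The state `π(t)` of the timed path `π` at time `t`: the state occupied after `n` jumps, where
`n` is least such that the first `n + 1` residence times add up to more than `t`. (If the residence
times never add up to more than `t`, which has probability zero, the value is irrelevant.) -/
noncomputable def stateAt (π : ℕ → S × ℝ≥0∞) (t : ℝ) : S :=
  if h : ∃ n, ENNReal.ofReal t < ∑ k ∈ Finset.range (n + 1), (π k).2 then (π (Nat.find h)).1
  else (π 0).1

/-- The generator `R - diag(E)`, with transition rates `R(s,s') = Δ(s)(s') · E(s)`. -/
noncomputable def generator [DecidableEq S] (M : CTMC S C) : Matrix S S ℝ :=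
  Matrix.of (fun s s' => (M.jump s s').toReal * (M.rate s : ℝ)) -
    Matrix.diagonal (fun s => (M.rate s : ℝ))

open Classical in
/-- The transient probability of being in `s'` after time `t` when starting in `s`. -/
noncomputable def transient [Fintype S] (M : CTMC S C) (t : ℝ) (s s' : S) : ℝ :=
  NormedSpace.exp (t • M.generator) s s'

end CTMC

/-! ## Evidence -/

/-- Imprecisely timed evidence with `n + 1` observations: for each observation a nonempty finite
union of compact intervals of positive times, and a label; the order of the observations is
known. -/
structure ImpreciseEvidence (C : Type*) (n : ℕ) where
  times : Fin (n + 1) → Set ℝ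
  label : Fin (n + 1) → C
  isUnion : ∀ i, ∃ (q : ℕ) (lo hi : Fin (q + 1) → ℝ), (∀ j, lo j ≤ hi j) ∧
    times i = ⋃ j, Set.Icc (lo j) (hi j)
  pos : ∀ i, ∀ t ∈ times i, 0 < t
  ordered : ∀ i j, i < j → ∀ t ∈ times i, ∀ t' ∈ times j, t < t'

namespace ImpreciseEvidence

variable {S C : Type*} {n : ℕ}

/-- A precise instance `ρ ∈ Ω` of the imprecise evidence; the labels are those of `Ω`. -/
abbrev Instance (Ω : ImpreciseEvidence C n) : Type := ∀ i, Ω.times i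

/-- The paths that are consistent with the precise evidence `ρ`. -/
def consistentPaths (Ω : ImpreciseEvidence C n) (M : CTMC S C) (ρ : Ω.Instance) :
    Set (ℕ → S × ℝ≥0∞) :=
  {π | ∀ i, M.label (CTMC.stateAt π (ρ i)) = Ω.label i}

/-- The conditional probability that the state at the last observation time is `s`, given the
evidence `ρ`; in `ℝ≥0∞`, `0 / 0 = 0`. -/
noncomputable def condProb [Fintype S] [MeasurableSpace S] [DiscreteMeasurableSpace S]
    (Ω : ImpreciseEvidence C n) (M : CTMC S C) (ρ : Ω.Instance) (s : S) : ℝ≥0∞ :=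
  M.pathMeasure ({π | CTMC.stateAt π (ρ (Fin.last n)) = s} ∩ Ω.consistentPaths M ρ) /
    M.pathMeasure (Ω.consistentPaths M ρ)

/-- The (maximal) weighted conditional reachability probability `W(Ω)`. -/
noncomputable def weightedReach [Fintype S] [MeasurableSpace S] [DiscreteMeasurableSpace S]
    (Ω : ImpreciseEvidence C n) (M : CTMC S C) (w : S → ℝ≥0) : ℝ≥0∞ :=
  ⨆ ρ : Ω.Instance, ∑ s, Ω.condProb M ρ s * w s

/-! ## Evidence graph, unfolded MDP and conditioned MDP -/

/-- Nodes of the evidence graph of `Ω`: the time `0`, the times of the observations (the sets of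
times are disjoint, so the index `i` is determined by the time) and the terminal node `t_⋆`. -/
inductive Node (Ω : ImpreciseEvidence C n) : Type
  | init : Node Ω
  | obs (i : Fin (n + 1)) (t : Ω.times i) : Node Ω
  | term : Node Ω

/-- The time of a node (the value at `t_⋆` is never used). -/
def Node.time {Ω : ImpreciseEvidence C n} : Node Ω → ℝ
  | .init => 0
  | .obs _ t => t
  | .term => 0

/-- The `k`-th node of the path `0, t_1, …, t_d, t_⋆` (with `d = n + 1`) that is the graph of the
precise evidence `ρ`. -/
def pathNode (Ω : ImpreciseEvidence C n) (ρ : Ω.Instance) : ℕ → Node Ω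
  | 0 => .init
  | k + 1 => if h : k < n + 1 then .obs ⟨k, h⟩ (ρ ⟨k, h⟩) else .term

/-- The edges of the evidence graph of `Ω`: the union over all instances `ρ` of the edges
`0 → t_1 → ⋯ → t_d → t_⋆`. -/
def Edge (Ω : ImpreciseEvidence C n) (x y : Node Ω) : Prop :=
  ∃ ρ : Ω.Instance, ∃ k ≤ n + 1, x = Ω.pathNode ρ k ∧ y = Ω.pathNode ρ (k + 1)

/-- The actions enabled in an MDP state with time node `x`: the successors of `x`; the terminal
states are absorbing, i.e. they have the single action `t_⋆`, which will be a self-loop. -/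
def enabledActions (Ω : ImpreciseEvidence C n) (x : Node Ω) : Set (Node Ω) :=
  {y | Ω.Edge x y ∨ (x = .term ∧ y = .term)}

open Classical in
/-- Transition function of the unfolded MDP, for enabled actions. -/
noncomputable def unfoldTrans [Fintype S] (Ω : ImpreciseEvidence C n) (M : CTMC S C)
    (q : S × Node Ω) (a : Node Ω) (q' : S × Node Ω) : ℝ :=
  if q'.2 = a then
    if a = .term then (if q.1 = q'.1 then 1 else 0)
    else M.transient (a.time - q.2.time) q.1 q'.1
  else 0

/-- The MDP states that disagree with the evidence. -/
def resetStates (Ω : ImpreciseEvidence C n) (M : CTMC S C) : Set (S × Node Ω) :=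
  {q | ∃ i t, q.2 = .obs i t ∧ M.label q.1 ≠ Ω.label i}

open Classical in
/-- Transition function of the conditioned MDP, for enabled actions: as in the unfolded MDP, but
states that disagree with the evidence are looped back to the initial state with probability
one. -/
noncomputable def condTrans [Fintype S] (Ω : ImpreciseEvidence C n) (M : CTMC S C)
    (q : S × Node Ω) (a : Node Ω) (q' : S × Node Ω) : ℝ :=
  if q ∈ Ω.resetStates M then (if q' = (M.init, .init) then 1 else 0)
  else Ω.unfoldTrans M q a q'

end ImpreciseEvidence

/-! ## Interval MDPs -/

/-- An interval MDP; the intervals are meaningful for enabled actions only. -/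
structure IMDP (Q A : Type*) where
  init : Q
  enabled : Q → Set A
  interval : Q → A → Q → Set ℝ

namespace IMDP

variable {Q A : Type*}

/-- The transition functions `P ∈ 𝒫`: distributions all of whose entries (for enabled actions) lie
in the prescribed intervals. -/
def Trans (I : IMDP Q A) : Type _ :=
  {P : Q → A → PMF Q // ∀ q, ∀ a ∈ I.enabled q, ∀ q', (P q a q').toReal ∈ I.interval q a q'}

/-- Memoryless schedulers. -/
def Sched (I : IMDP Q A) : Type _ :=
  {σ : Q → A // ∀ q, σ q ∈ I.enabled q}

/-- The probability that the Markov chain induced by `P` and `σ` eventually reaches `q`. -/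
noncomputable def reach (I : IMDP Q A) (P : I.Trans) (σ : I.Sched) (q : Q) : ℝ≥0∞ :=
  reachProb (fun q' => P.1 q' (σ.1 q')) I.init q

end IMDP

/-! ## Time partitions and the abstraction -/

/-- A time partition of `Ω`: for each observation, finitely many sets that cover its set of times
and have pairwise disjoint interiors. Since elements may share boundary points, the datum
`cell i t` is the element `Ψ(t)` to which the time `t` is assigned. -/
structure TimePartition {C : Type*} {n : ℕ} (Ω : ImpreciseEvidence C n) where
  card : Fin (n + 1) → ℕ
  part : ∀ i, Fin (card i) → Set ℝ
  cover : ∀ i, ⋃ j, part i j = Ω.times i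
  disjoint_interior : ∀ i j k, j ≠ k → Disjoint (interior (part i j)) (interior (part i k))
  cell : ∀ i, Ω.times i → Fin (card i)
  mem_cell : ∀ i (t : Ω.times i), (t : ℝ) ∈ part i (cell i t)

namespace TimePartition

variable {S C : Type*} {n : ℕ} {Ω : ImpreciseEvidence C n}

/-- The elements `Ψ(t)` of the time partition, for all nodes `t` of the evidence graph. -/
inductive AbsNode (Ψ : TimePartition Ω) : Type
  | init : AbsNode Ψ
  | obs (i : Fin (n + 1)) (j : Set.range (Ψ.cell i)) : AbsNode Ψ
  | term : AbsNode Ψ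

/-- The map `t ↦ Ψ(t)`. -/
def abs (Ψ : TimePartition Ω) : Ω.Node → Ψ.AbsNode
  | .init => .init
  | .obs i t => .obs i ⟨Ψ.cell i t, t, rfl⟩
  | .term => .term

/-- The iMDP abstraction of the conditioned MDP: states `(s, Ψ(t))`, actions `Ψ(t)`, and as interval
the closure `[inf, sup]` of the set of all probabilities with which states `(s, t)`, `Ψ(t) = x`,
move under actions `t'`, `Ψ(t') = a`, into the set of MDP states represented by `q'`. -/
noncomputable def abstraction [Fintype S] (Ψ : TimePartition Ω) (M : CTMC S C) :
    IMDP (S × Ψ.AbsNode) Ψ.AbsNode where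
  init := (M.init, .init)
  enabled q := {a | ∃ t t', Ψ.abs t = q.2 ∧ Ψ.abs t' = a ∧ t' ∈ Ω.enabledActions t}
  interval q a q' :=
    let probs : Set ℝ := {p | ∃ t t', Ψ.abs t = q.2 ∧ Ψ.abs t' = a ∧ t' ∈ Ω.enabledActions t ∧
      p = ∑ᶠ t'' ∈ {t'' | Ψ.abs t'' = q'.2}, Ω.condTrans M (q.1, t) t' (q'.1, t'')}
    Set.Icc (sInf probs) (sSup probs)

/-- The value of the MDP induced by `P` under the scheduler `σ`. -/
noncomputable def value [Fintype S] (Ψ : TimePartition Ω) (M : CTMC S C) (w : S → ℝ≥0)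
    (P : (Ψ.abstraction M).Trans) (σ : (Ψ.abstraction M).Sched) : ℝ≥0∞ :=
  ∑ s, (Ψ.abstraction M).reach P σ (s, .term) * w s

/-- A scheduler of the abstraction is consistent if for some instance `ρ` of `Ω`, with times
`t_1, …, t_d`, it picks in every CTMC state the action `Ψ(t_1)` at time `0`, the action
`Ψ(t_{i+1})` at `Ψ(t_i)`, and the action `t_⋆` at `Ψ(t_d)`. -/
def Consistent [Fintype S] (Ψ : TimePartition Ω) (M : CTMC S C)
    (σ : (Ψ.abstraction M).Sched) : Prop :=
  ∃ ρ : Ω.Instance, ∀ s : S, ∀ k ≤ n + 1,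
    σ.1 (s, Ψ.abs (Ω.pathNode ρ k)) = Ψ.abs (Ω.pathNode ρ (k + 1))

end TimePartition

/-! Fix a transition function `P` and a scheduler `σ` of the abstraction. Every action either resets
to the initial state, moves to the next observation, or enters an absorbing terminal state. So a
pass that leaves the initial state ends, after boundedly many steps, either in a terminal state or
back where it began. By a renewal argument the probability of eventually reaching `(s, t_⋆)` is `p_s
/ d`, where `p_s` is the probability that one pass ends in `(s, t_⋆)` and `d` that it ends in any
terminal state (`reachProb_eq_div`, `reach_abstraction`). Resetting thus implements conditioning,
including the convention `0 / 0 = 0`.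

Both inequalities with `W(Ω)` rest on one equality (`exists_value_eq`): if `σ` follows an instance
`ρ`, some admissible `P` has exactly the conditional value of `ρ`. The abstract nodes along `ρ` are
pairwise distinct and the intervals contain the true probabilities, so `P` can copy the conditioned
MDP along `ρ`. One pass then has probabilities `p_s = ℙ(π(t_d) = s, π ⊨ ρ)` and `d = ℙ(π ⊨ ρ)`.
Every instance is followed by some consistent scheduler, which bounds `W(Ω)` from above; every
consistent scheduler follows some instance, which bounds the minimum.

This needs the finite-dimensional distributions of the timed-path measure (`pathsFrom_stateAt`).
They follow from memorylessness of residence times, and from expanding the matrix exponential over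
the number of jumps by iterating Kolmogorov's backward equation; the remainder after `k` jumps
decays geometrically (`jumpRemainder_le`), which also excludes explosion.

Attainment for fixed `σ` is not plain compactness, because the quotient may be discontinuous where
`d = 0`. Instead, no row is used twice within a pass, so numerator and denominator are affine in
each row separately; a quotient of such functions is maximal at a vertex of the row's polytope
(`IsAffineOn.exists_le_div`), and there are finitely many choices of vertices. Schedulers are finite
in number. -/

/-! ## First-step decomposition of Markov chains -/

section Chain

variable {X : Type*} [MeasurableSpace X]

/-- The sequence `x, ω 0, ω 1, …`. -/
def consPath {X : Type*} (x : X) (ω : ℕ → X) : ℕ → X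
  | 0 => x
  | n + 1 => ω n

@[simp] lemma consPath_zero {X : Type*} (x : X) (ω : ℕ → X) : consPath x ω 0 = x := rfl

@[simp] lemma consPath_succ {X : Type*} (x : X) (ω : ℕ → X) (n : ℕ) :
    consPath x ω (n + 1) = ω n := rfl

lemma measurable_consPath_uncurry : Measurable fun p : X × (ℕ → X) => consPath p.1 p.2 := by
  refine measurable_pi_iff.2 fun n => ?_
  cases n with
  | zero => exact measurable_fst
  | succ n => exact (measurable_pi_apply n).comp measurable_snd

@[fun_prop]
lemma measurable_consPath (x : X) : Measurable (consPath x) :=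
  measurable_consPath_uncurry.comp measurable_prodMk_left

/-- The sequences whose first `n + 1` entries lie in prescribed sets. -/
def pathBox {X : Type*} (n : ℕ) (A : ℕ → Set X) : Set (ℕ → X) := {ω | ∀ i ≤ n, ω i ∈ A i}

lemma measurableSet_pathBox (n : ℕ) {A : ℕ → Set X} (hA : ∀ i, MeasurableSet (A i)) :
    MeasurableSet (pathBox n A) := by
  have : pathBox n A = ⋂ i, ⋂ (_ : i ≤ n), (fun ω : ℕ → X => ω i) ⁻¹' A i := by
    ext; simp [pathBox]
  rw [this]
  exact MeasurableSet.iInter fun i => MeasurableSet.iInter fun _ => measurable_pi_apply i (hA i)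

lemma pathBox_succ {X : Type*} (n : ℕ) (A : ℕ → Set X) :
    pathBox (n + 1) A = pathBox n A ∩ (fun ω : ℕ → X => ω (n + 1)) ⁻¹' A (n + 1) := by
  ext ω
  simp only [pathBox, Set.mem_ofPred_eq, Set.mem_inter_iff, Set.mem_preimage]
  refine ⟨fun h => ⟨fun i hi => h i (by lia), h _ le_rfl⟩, fun h i hi => ?_⟩
  rcases Nat.lt_or_ge i (n + 1) with hlt | hge
  · exact h.1 i (by lia)
  · obtain rfl : i = n + 1 := by lia
    exact h.2

/-- A law on sequences has transition kernel `κ` if this holds for the conditional law of each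
entry given the previous ones. -/
def HasTransition (κ : Kernel X X) (ν : Measure (ℕ → X)) : Prop :=
  ∀ (n : ℕ) (A : ℕ → Set X), (∀ i, MeasurableSet (A i)) → ∀ g : X → ℝ≥0∞, Measurable g →
    ∫⁻ ω in pathBox n A, g (ω (n + 1)) ∂ν = ∫⁻ ω in pathBox n A, ∫⁻ y, g y ∂κ (ω n) ∂ν

/-- The integrand `g` in the last coordinate makes the induction close: integrating out the last
entry turns the constraint `A (n + 1)` into a new function of the previous entry. -/
lemma HasTransition.setLIntegral_eq {κ : Kernel X X} [IsMarkovKernel κ] {ν ν' : Measure (ℕ → X)}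
    (h : HasTransition κ ν) (h' : HasTransition κ ν')
    (h0 : ν.map (fun ω => ω 0) = ν'.map (fun ω => ω 0)) (n : ℕ) {A : ℕ → Set X}
    (hA : ∀ i, MeasurableSet (A i)) {g : X → ℝ≥0∞} (hg : Measurable g) :
    ∫⁻ ω in pathBox n A, g (ω n) ∂ν = ∫⁻ ω in pathBox n A, g (ω n) ∂ν' := by
  induction n generalizing g with
  | zero =>
    have key : ∀ μ : Measure (ℕ → X), ∫⁻ ω in pathBox 0 A, g (ω 0) ∂μ
        = ∫⁻ x in A 0, g x ∂μ.map (fun ω => ω 0) := by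
      intro μ
      rw [setLIntegral_map (hA 0) hg (measurable_pi_apply 0)]
      congr 2
      ext ω
      simp [pathBox]
    rw [key, key, h0]
  | succ n ih =>
    have key : ∀ μ : Measure (ℕ → X), HasTransition κ μ →
        ∫⁻ ω in pathBox (n + 1) A, g (ω (n + 1)) ∂μ
        = ∫⁻ ω in pathBox n A, ∫⁻ y in A (n + 1), g y ∂κ (ω n) ∂μ := by
      intro μ hμ
      have := hμ n A hA ((A (n + 1)).indicator g) (hg.indicator (hA _))
      simp only [lintegral_indicator (hA (n + 1))] at this
      rw [← this, pathBox_succ, Set.inter_comm,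
        ← Measure.restrict_restrict (measurable_pi_apply (n + 1) (hA _)),
        ← lintegral_indicator (measurable_pi_apply (n + 1) (hA _))]
      rfl
    rw [key ν h, key ν' h']
    exact ih (g := fun x => ∫⁻ y in A (n + 1), g y ∂κ x) (hg.setLIntegral_kernel (hA _))

/-- Cylinders over finitely many coordinates form a generating π-system, and each is a `pathBox`
with trivial constraints at the remaining coordinates. -/
lemma HasTransition.eq {κ : Kernel X X} [IsMarkovKernel κ] {ν ν' : Measure (ℕ → X)}
    [IsProbabilityMeasure ν] [IsProbabilityMeasure ν']
    (h : HasTransition κ ν) (h' : HasTransition κ ν')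
    (h0 : ν.map (fun ω => ω 0) = ν'.map (fun ω => ω 0)) : ν = ν' := by
  refine ext_of_generate_finite _ (generateFrom_squareCylinders (α := fun _ : ℕ => X)).symm
    (isPiSystem_squareCylinders (fun _ => MeasurableSpace.isPiSystem_measurableSet)
      fun _ => MeasurableSet.univ) ?_ (by simp)
  rintro _ ⟨s, t, ht, rfl⟩
  classical
  have hA : ∀ i, MeasurableSet (if i ∈ s then t i else Set.univ) := by
    intro i
    split_ifs
    · exact ht i (Set.mem_univ i)
    · exact MeasurableSet.univ
  have hbox : (s : Set ℕ).pi t = pathBox (s.sup id) fun i => if i ∈ s then t i else Set.univ := by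
    ext ω
    simp only [Set.mem_pi, Finset.mem_coe, pathBox, Set.mem_ofPred_eq]
    refine ⟨fun h i _ => ?_, fun h i hi => ?_⟩
    · split_ifs with hi
      · exact h i hi
      · trivial
    · simpa [hi] using h i (Finset.le_sup (f := id) hi)
  have := h.setLIntegral_eq h' h0 (s.sup id) hA (g := fun _ => 1) measurable_const
  simp only [lintegral_const, one_mul, Measure.restrict_apply_univ] at this
  rw [hbox, this]

lemma chainMeasure_dirac (κ : Kernel X X) [IsMarkovKernel κ] (x : X) :
    chainMeasure κ (Measure.dirac x) =
      Kernel.traj (X := fun _ => X)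
        (fun n => κ.comap (fun h : (Finset.Iic n → X) => h ⟨n, Finset.mem_Iic.2 le_rfl⟩)
        (measurable_pi_apply _)) 0 (fun _ => x) := by
  rw [chainMeasure, Measure.map_dirac' (by fun_prop), Measure.dirac_bind (Kernel.measurable _)]

lemma lintegral_chainMeasure (κ : Kernel X X) [IsMarkovKernel κ] (μ : Measure X)
    {F : (ℕ → X) → ℝ≥0∞} (hF : Measurable F) :
    ∫⁻ ω, F ω ∂chainMeasure κ μ = ∫⁻ x, ∫⁻ ω, F ω ∂chainMeasure κ (Measure.dirac x) ∂μ := by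
  simp_rw [chainMeasure_dirac]
  rw [chainMeasure, Measure.lintegral_bind (Kernel.measurable _).aemeasurable hF.aemeasurable,
    lintegral_map hF.lintegral_kernel (by fun_prop)]

lemma measurable_lintegral_chainMeasure_dirac (κ : Kernel X X) [IsMarkovKernel κ]
    {F : (ℕ → X) → ℝ≥0∞} (hF : Measurable F) :
    Measurable fun x => ∫⁻ ω, F ω ∂chainMeasure κ (Measure.dirac x) := by
  simp_rw [chainMeasure_dirac]
  exact hF.lintegral_kernel.comp (by fun_prop : Measurable fun (x : X) (_ : Finset.Iic 0) => x)

instance (κ : Kernel X X) [IsMarkovKernel κ] (μ : Measure X) [IsProbabilityMeasure μ] :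
    IsProbabilityMeasure (chainMeasure κ μ) := by
  constructor
  have h := lintegral_chainMeasure κ μ (F := fun _ => 1) measurable_const
  simpa [chainMeasure_dirac] using h

/-- The joint law of a prefix and the next entry under `Kernel.traj` is the composition product of
the prefix law with the kernel; both integrals become integrals over prefixes. -/
lemma hasTransition_chainMeasure_dirac (κ : Kernel X X) [IsMarkovKernel κ] (x : X) :
    HasTransition κ (chainMeasure κ (Measure.dirac x)) := by
  intro n A hA g hg
  rw [chainMeasure_dirac]
  set η : (n : ℕ) → Kernel (Finset.Iic n → X) X := fun n =>
    κ.comap (fun h : (Finset.Iic n → X) => h ⟨n, Finset.mem_Iic.2 le_rfl⟩)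
      (measurable_pi_apply _) with hη
  have hcomp := Kernel.partialTraj_compProd_eq_map_traj (X := fun _ => X) (κ := η)
    (Nat.zero_le n) (x₀ := fun _ => x)
  have hmap := Kernel.traj_map_frestrictLe_apply (X := fun _ => X) (κ := η) 0 n (fun _ => x)
  set B : Set (Finset.Iic n → X) := {h | ∀ i (hi : i ≤ n), h ⟨i, Finset.mem_Iic.2 hi⟩ ∈ A i} with hB
  have hBm : MeasurableSet B := by
    have : B = ⋂ i, ⋂ (hi : i ≤ n),
        (fun h : Finset.Iic n → X => h ⟨i, Finset.mem_Iic.2 hi⟩) ⁻¹' A i := by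
      ext; simp [hB]
    rw [this]
    exact MeasurableSet.iInter fun i => MeasurableSet.iInter fun _ => measurable_pi_apply _ (hA i)
  have hpre : pathBox n A = Preorder.frestrictLe n ⁻¹' B := rfl
  set τ := Kernel.traj (X := fun _ => X) η 0 (fun _ => x)
  have hbm := measurableSet_pathBox n hA
  have hgm : Measurable ((B ×ˢ Set.univ).indicator fun p : (Finset.Iic n → X) × X => g p.2) :=
    (hg.comp measurable_snd).indicator (hBm.prod MeasurableSet.univ)
  have e1 : ∫⁻ ω in pathBox n A, g (ω (n + 1)) ∂τ
      = ∫⁻ p, (B ×ˢ Set.univ).indicator (fun p => g p.2) p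
        ∂τ.map (fun ω => (Preorder.frestrictLe (π := fun _ => X) n ω, ω (n + 1))) := by
    rw [lintegral_map hgm (by fun_prop), ← lintegral_indicator hbm]
    refine lintegral_congr fun ω => ?_
    have hiff : ω ∈ pathBox n A ↔
        (Preorder.frestrictLe (π := fun _ => X) n ω, ω (n + 1)) ∈ B ×ˢ (Set.univ : Set X) :=
      ⟨fun h => ⟨h, trivial⟩, fun h => h.1⟩
    by_cases h : ω ∈ pathBox n A
    · rw [Set.indicator_of_mem h, Set.indicator_of_mem (hiff.1 h)]
    · rw [Set.indicator_of_notMem h, Set.indicator_of_notMem (fun h' => h (hiff.2 h'))]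
  have e2 : ∫⁻ ω in pathBox n A, ∫⁻ y, g y ∂κ (ω n) ∂τ
      = ∫⁻ h, B.indicator (fun h => ∫⁻ y, g y ∂η n h) h
        ∂τ.map (Preorder.frestrictLe (π := fun _ => X) n) := by
    rw [lintegral_map (Measurable.indicator hg.lintegral_kernel hBm) (by fun_prop),
      ← lintegral_indicator hbm]
    rfl
  rw [e1, e2, ← hcomp, hmap, Measure.lintegral_compProd hgm]
  refine lintegral_congr fun h => ?_
  by_cases hh : h ∈ B <;> simp [Set.indicator, hh]

lemma hasTransition_chainMeasure (κ : Kernel X X) [IsMarkovKernel κ] (μ : Measure X) :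
    HasTransition κ (chainMeasure κ μ) := by
  intro n A hA g hg
  have hb := measurableSet_pathBox n hA
  rw [← lintegral_indicator hb, ← lintegral_indicator hb,
    lintegral_chainMeasure κ μ (F := (pathBox n A).indicator fun ω => g (ω (n + 1)))
      ((hg.comp (measurable_pi_apply _)).indicator hb),
    lintegral_chainMeasure κ μ (F := (pathBox n A).indicator fun ω => ∫⁻ y, g y ∂κ (ω n))
      ((hg.lintegral_kernel.comp (measurable_pi_apply n)).indicator hb)]
  refine lintegral_congr fun x => ?_
  rw [lintegral_indicator hb, lintegral_indicator hb]
  exact hasTransition_chainMeasure_dirac κ x n A hA g hg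

lemma chainMeasure_dirac_map_zero (κ : Kernel X X) [IsMarkovKernel κ] (x : X) :
    (chainMeasure κ (Measure.dirac x)).map (fun ω => ω 0) = Measure.dirac x := by
  rw [chainMeasure_dirac]
  set η : (n : ℕ) → Kernel (Finset.Iic n → X) X := fun n =>
    κ.comap (fun h : (Finset.Iic n → X) => h ⟨n, Finset.mem_Iic.2 le_rfl⟩)
      (measurable_pi_apply _) with hη
  have hmap := Kernel.traj_map_frestrictLe_apply (X := fun _ => X) (κ := η) 0 0 (fun _ => x)
  have : (fun ω : ℕ → X => ω 0)
      = (fun h : Finset.Iic 0 → X => h ⟨0, Finset.mem_Iic.2 le_rfl⟩) ∘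
        Preorder.frestrictLe (π := fun _ => X) 0 := rfl
  rw [this, ← Measure.map_map (by fun_prop) (by fun_prop), hmap, Kernel.partialTraj_self,
    Kernel.id_apply, Measure.map_dirac' (by fun_prop)]

lemma chainMeasure_map_zero (κ : Kernel X X) [IsMarkovKernel κ] (μ : Measure X) :
    (chainMeasure κ μ).map (fun ω => ω 0) = μ := by
  ext A hA
  have hm : Measurable ((fun ω : ℕ → X => ω 0) ⁻¹' A |>.indicator (1 : (ℕ → X) → ℝ≥0∞)) :=
    measurable_one.indicator (measurable_pi_apply 0 hA)
  rw [Measure.map_apply (measurable_pi_apply 0) hA,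
    ← lintegral_indicator_one (measurable_pi_apply 0 hA), lintegral_chainMeasure _ _ hm]
  have : ∀ x, ∫⁻ ω, ((fun ω : ℕ → X => ω 0) ⁻¹' A |>.indicator (1 : (ℕ → X) → ℝ≥0∞)) ω
      ∂chainMeasure κ (Measure.dirac x) = A.indicator 1 x := by
    intro x
    rw [lintegral_indicator_one (measurable_pi_apply 0 hA),
      ← Measure.map_apply (measurable_pi_apply 0) hA, chainMeasure_dirac_map_zero,
      Measure.dirac_apply' _ hA]
  simp_rw [this]
  rw [lintegral_indicator_one hA]

/-- First-step decomposition of a Markov chain started in `x`. -/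
lemma chainMeasure_dirac_eq_map_consPath (κ : Kernel X X) [IsMarkovKernel κ] (x : X) :
    chainMeasure κ (Measure.dirac x) = (chainMeasure κ (κ x)).map (consPath x) := by
  have : IsProbabilityMeasure ((chainMeasure κ (κ x)).map (consPath x)) :=
    Measure.isProbabilityMeasure_map (measurable_consPath x).aemeasurable
  -- By uniqueness it suffices that the prolonged law starts in `x` and has transition kernel `κ`.
  refine (hasTransition_chainMeasure_dirac κ x).eq (κ := κ) ?_ ?_
  · intro n A hA g hg
    have hb := measurableSet_pathBox n hA
    rw [setLIntegral_map (f := fun ω => g (ω (n + 1))) hb (by fun_prop)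
        (measurable_consPath x),
      setLIntegral_map (f := fun ω => ∫⁻ y, g y ∂κ (ω n)) hb
        (Measurable.comp (g := fun x => ∫⁻ y, g y ∂κ x) hg.lintegral_kernel (measurable_pi_apply n))
        (measurable_consPath x)]
    by_cases hx : x ∈ A 0
    swap
    · have : consPath x ⁻¹' pathBox n A = ∅ := by
        ext ω
        simp only [Set.mem_preimage, pathBox, Set.mem_ofPred_eq, Set.mem_empty_iff_false, iff_false]
        exact fun h => hx (h 0 (Nat.zero_le n))
      simp [this]
    -- The transition out of `x` is the initial law `κ x` of the tail; later transitions are those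
    -- of the tail itself.
    cases n with
    | zero =>
      have : consPath x ⁻¹' pathBox 0 A = Set.univ := by
        ext ω
        simp [pathBox, hx]
      have h0 := chainMeasure_map_zero κ (κ x)
      simp only [this, Measure.restrict_univ, consPath_succ, consPath_zero, lintegral_const,
        measure_univ, mul_one]
      rw [← h0, lintegral_map hg (measurable_pi_apply 0), h0]
    | succ n =>
      have : consPath x ⁻¹' pathBox (n + 1) A = pathBox n fun i => A (i + 1) := by
        ext ω
        simp only [Set.mem_preimage, pathBox, Set.mem_ofPred_eq]
        refine ⟨fun h i hi => h (i + 1) (by lia), fun h i hi => ?_⟩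
        cases i with
        | zero => exact hx
        | succ i => exact h i (by lia)
      rw [this]
      exact hasTransition_chainMeasure κ (κ x) n _ (fun i => hA (i + 1)) g hg
  · rw [Measure.map_map (measurable_pi_apply 0) (measurable_consPath x),
      chainMeasure_dirac_map_zero]
    have : (fun ω : ℕ → X => ω 0) ∘ consPath x = fun _ => x := rfl
    rw [this, Measure.map_const, measure_univ, one_smul]

lemma lintegral_chainMeasure_dirac (κ : Kernel X X) [IsMarkovKernel κ] (x : X)
    {F : (ℕ → X) → ℝ≥0∞} (hF : Measurable F) :
    ∫⁻ ω, F ω ∂chainMeasure κ (Measure.dirac x)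
      = ∫⁻ ω, F (consPath x ω) ∂chainMeasure κ (κ x) := by
  rw [chainMeasure_dirac_eq_map_consPath, lintegral_map hF (measurable_consPath x)]

end Chain

/-! ## Reachability in finite Markov chains -/

section Reach

lemma measurableSet_visit {Q : Type*} (z : Q) (I : Set ℕ) :
    @MeasurableSet _ (@MeasurableSpace.pi _ _ fun _ => ⊤) {ξ : ℕ → Q | ∃ k ∈ I, ξ k = z} := by
  let _ : MeasurableSpace Q := ⊤
  have : {ξ : ℕ → Q | ∃ k ∈ I, ξ k = z} = ⋃ k ∈ I, (fun ξ : ℕ → Q => ξ k) ⁻¹' {z} := by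
    ext; simp
  rw [this]
  exact MeasurableSet.biUnion (Set.to_countable _) fun k _ => measurable_pi_apply k trivial

variable {Q : Type*} [Fintype Q]

lemma PMF.sum_coe_fintype (p : PMF Q) : ∑ q, p q = 1 := by
  rw [← tsum_fintype (L := .unconditional Q), p.tsum_coe]

lemma lintegral_discrete_chain (K : Q → PMF Q) (q : Q) {F : (ℕ → Q) → ℝ≥0∞}
    (hF : @Measurable _ _ (@MeasurableSpace.pi _ _ fun _ => ⊤) _ F) :
    letI : MeasurableSpace Q := ⊤
    ∫⁻ ω, F ω ∂chainMeasure (discreteKernel K) (Measure.dirac q)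
      = ∑ q', K q q' *
        ∫⁻ ω, F (consPath q ω) ∂chainMeasure (discreteKernel K) (Measure.dirac q') := by
  let _ : MeasurableSpace Q := ⊤
  have : MeasurableSingletonClass Q := ⟨fun _ => trivial⟩
  show ∫⁻ ω, F ω ∂chainMeasure (discreteKernel K) (Measure.dirac q) = _
  rw [lintegral_chainMeasure_dirac _ _ hF, lintegral_chainMeasure _ _
    (F := fun ω => F (consPath q ω)) (hF.comp (measurable_consPath q)), lintegral_fintype]
  refine Finset.sum_congr rfl fun q' _ => ?_
  rw [mul_comm]
  congr 1
  exact PMF.toMeasure_apply_singleton (K q) q' trivial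

/-- `J` is the set of times `I` seen after one step. Taking all times gives the reachability
equation, taking initial segments gives the induction over bounded reachability. -/
lemma visit_measure_eq (K : Q → PMF Q) (q z : Q) (I J : Set ℕ) (h0 : 0 ∈ I)
    (hJ : ∀ k, k + 1 ∈ I ↔ k ∈ J) [Decidable (q = z)] :
    letI : MeasurableSpace Q := ⊤
    chainMeasure (discreteKernel K) (Measure.dirac q) {ξ | ∃ k ∈ I, ξ k = z}
      = if q = z then 1 else ∑ q', K q q' *
        chainMeasure (discreteKernel K) (Measure.dirac q') {ξ | ∃ k ∈ J, ξ k = z} := by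
  let _ : MeasurableSpace Q := ⊤
  show chainMeasure (discreteKernel K) (Measure.dirac q) {ξ | ∃ k ∈ I, ξ k = z} = _
  have hI := measurableSet_visit z I
  rw [← lintegral_indicator_one hI, lintegral_discrete_chain K q (measurable_one.indicator hI)]
  split_ifs with h
  · have hmem : ∀ ω, consPath q ω ∈ {ξ : ℕ → Q | ∃ k ∈ I, ξ k = z} := fun ω => ⟨0, h0, h⟩
    have : ∀ ω, ({ξ : ℕ → Q | ∃ k ∈ I, ξ k = z}.indicator (1 : (ℕ → Q) → ℝ≥0∞)) (consPath q ω)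
        = 1 := fun ω => Set.indicator_of_mem (hmem ω) _
    simp only [this, lintegral_const, measure_univ, mul_one]
    exact (K q).sum_coe_fintype
  · refine Finset.sum_congr rfl fun q' _ => ?_
    rw [← lintegral_indicator_one (measurableSet_visit z J)]
    congr 2
    ext ω
    have hiff : consPath q ω ∈ {ξ : ℕ → Q | ∃ k ∈ I, ξ k = z} ↔
        ω ∈ {ξ : ℕ → Q | ∃ k ∈ J, ξ k = z} := by
      refine ⟨?_, ?_⟩
      · rintro ⟨k, hk, hkz⟩
        cases k with
        | zero => exact absurd hkz h
        | succ k => exact ⟨k, (hJ k).1 hk, hkz⟩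
      · rintro ⟨k, hk, hkz⟩
        exact ⟨k + 1, (hJ k).2 hk, hkz⟩
    by_cases hω : ω ∈ {ξ : ℕ → Q | ∃ k ∈ J, ξ k = z}
    · rw [Set.indicator_of_mem hω, Set.indicator_of_mem (hiff.2 hω)]; rfl
    · rw [Set.indicator_of_notMem hω, Set.indicator_of_notMem (fun h' => hω (hiff.1 h'))]

lemma reachProb_eq (K : Q → PMF Q) (q z : Q) [Decidable (q = z)] :
    reachProb K q z = if q = z then 1 else ∑ q', K q q' * reachProb K q' z := by
  have h := visit_measure_eq K q z Set.univ Set.univ trivial (fun _ => by simp)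
  simp only [Set.mem_univ, true_and] at h
  exact h

/-- Reachability probabilities are the least solution of their fixed point inequality. -/
lemma reachProb_le (K : Q → PMF Q) (z : Q) (g : Q → ℝ≥0∞) (hz : 1 ≤ g z)
    (hg : ∀ q, ∑ q', K q q' * g q' ≤ g q) (q : Q) : reachProb K q z ≤ g q := by
  classical
  let _ : MeasurableSpace Q := ⊤
  have hk : ∀ k q, chainMeasure (discreteKernel K) (Measure.dirac q)
      {ξ | ∃ j ∈ Set.Iio k, ξ j = z} ≤ g q := by
    intro k
    induction k with
    | zero => intro q; simp
    | succ k ih =>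
      intro q
      have h := visit_measure_eq K q z (Set.Iio (k + 1)) (Set.Iio k) (by simp) (by simp)
      refine h.trans_le ?_
      split_ifs with hq
      · exact hq ▸ hz
      · exact (Finset.sum_le_sum fun q' _ => mul_le_mul_right (ih q') _).trans (hg q)
  have hU : {ξ : ℕ → Q | ∃ k, ξ k = z} = ⋃ k, {ξ | ∃ j ∈ Set.Iio k, ξ j = z} := by
    ext ξ
    simp only [Set.mem_ofPred_eq, Set.mem_iUnion, Set.mem_Iio]
    exact ⟨fun ⟨k, hk⟩ => ⟨k + 1, k, by lia, hk⟩, fun ⟨_, j, _, hj⟩ => ⟨j, hj⟩⟩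
  have hmono : Monotone fun k => {ξ : ℕ → Q | ∃ j ∈ Set.Iio k, ξ j = z} := by
    rintro a b hab ξ ⟨j, hj, hjz⟩
    exact ⟨j, lt_of_lt_of_le hj hab, hjz⟩
  show chainMeasure (discreteKernel K) (Measure.dirac q) {ξ | ∃ k, ξ k = z} ≤ g q
  rw [hU, hmono.measure_iUnion]
  exact iSup_le fun k => hk k q

lemma reachProb_le_one (K : Q → PMF Q) (q z : Q) : reachProb K q z ≤ 1 :=
  reachProb_le K z (fun _ => 1) le_rfl
    (fun q => by simp [(K q).sum_coe_fintype]) q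

end Reach

/-! ## Values at the first return -/

section HitVal

variable {Q : Type*} [Fintype Q]

open Classical in
/-- For the Markov chain with transition matrix `K`, the expected value of `f` at the first state
in `B` that is visited after at least one and at most `k` steps. -/
noncomputable def hitVal (K : Q → Q → ℝ) (B : Set Q) (f : Q → ℝ) : ℕ → Q → ℝ
  | 0, _ => 0
  | k + 1, q => ∑ q', K q q' * if q' ∈ B then f q' else hitVal K B f k q'

variable {K : Q → Q → ℝ} {B : Set Q} {f g : Q → ℝ}

lemma hitVal_congr (h : ∀ q ∈ B, f q = g q) (k : ℕ) (q : Q) :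
    hitVal K B f k q = hitVal K B g k q := by
  induction k generalizing q with
  | zero => rfl
  | succ k ih =>
    refine Finset.sum_congr rfl fun q' _ => ?_
    split_ifs with hq
    · rw [h q' hq]
    · rw [ih]

lemma hitVal_add (k : ℕ) (q : Q) :
    hitVal K B (fun q => f q + g q) k q = hitVal K B f k q + hitVal K B g k q := by
  induction k generalizing q with
  | zero => simp [hitVal]
  | succ k ih =>
    simp only [hitVal, ← Finset.sum_add_distrib, ih]
    refine Finset.sum_congr rfl fun q' _ => ?_
    split_ifs <;> ring

lemma hitVal_const_mul (c : ℝ) (k : ℕ) (q : Q) :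
    hitVal K B (fun q => c * f q) k q = c * hitVal K B f k q := by
  induction k generalizing q with
  | zero => simp [hitVal]
  | succ k ih =>
    simp only [hitVal, Finset.mul_sum, ih]
    refine Finset.sum_congr rfl fun q' _ => ?_
    split_ifs <;> ring

lemma hitVal_sum {ι : Type*} (s : Finset ι) (F : ι → Q → ℝ) (k : ℕ) (q : Q) :
    hitVal K B (fun q => ∑ i ∈ s, F i q) k q = ∑ i ∈ s, hitVal K B (F i) k q := by
  classical
  induction s using Finset.induction_on with
  | empty =>
    have := hitVal_const_mul (K := K) (B := B) (f := fun _ => 0) 0 k q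
    simpa using this
  | insert i s hi ih =>
    simp only [Finset.sum_insert hi]
    rw [hitVal_add, ih]

lemma hitVal_mono (hK : ∀ q q', 0 ≤ K q q') (h : ∀ q ∈ B, f q ≤ g q) (k : ℕ) (q : Q) :
    hitVal K B f k q ≤ hitVal K B g k q := by
  induction k generalizing q with
  | zero => rfl
  | succ k ih =>
    refine Finset.sum_le_sum fun q' _ => mul_le_mul_of_nonneg_left ?_ (hK q q')
    split_ifs with hq
    · exact h q' hq
    · exact ih q'

lemma hitVal_nonneg (hK : ∀ q q', 0 ≤ K q q') (h : ∀ q ∈ B, 0 ≤ f q) (k : ℕ) (q : Q) :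
    0 ≤ hitVal K B f k q := by
  induction k generalizing q with
  | zero => rfl
  | succ k ih =>
    refine Finset.sum_nonneg fun q' _ => mul_nonneg (hK q q') ?_
    split_ifs with hq
    · exact h q' hq
    · exact ih q'

lemma hitVal_le_succ (hK : ∀ q q', 0 ≤ K q q') (h : ∀ q ∈ B, 0 ≤ f q) (k : ℕ) (q : Q) :
    hitVal K B f k q ≤ hitVal K B f (k + 1) q := by
  induction k generalizing q with
  | zero => exact hitVal_nonneg hK h 1 q
  | succ k ih =>
    refine Finset.sum_le_sum fun q' _ => mul_le_mul_of_nonneg_left ?_ (hK q q')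
    split_ifs with hq
    · exact le_rfl
    · exact ih q'

/-- A superharmonic function that dominates `f` on `B` dominates the values at the first return. -/
lemma hitVal_le_of_superharmonic (hK : ∀ q q', 0 ≤ K q q') {h : Q → ℝ} (h0 : ∀ q, 0 ≤ h q)
    (hh : ∀ q, ∑ q', K q q' * h q' ≤ h q) (hB : ∀ q ∈ B, f q ≤ h q) (k : ℕ) (q : Q) :
    hitVal K B f k q ≤ h q := by
  induction k generalizing q with
  | zero => exact h0 q
  | succ k ih =>
    refine (Finset.sum_le_sum fun q' _ => mul_le_mul_of_nonneg_left ?_ (hK q q')).trans (hh q)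
    split_ifs with hq
    · exact hB q' hq
    · exact ih q'

/-- If `B` is always visited within `N` steps, more steps do not change the value. -/
lemma hitVal_succ_eq (hK : ∀ q q', 0 ≤ K q q') (hsum : ∀ q, ∑ q', K q q' = 1) {N : ℕ}
    (hN : ∀ q, hitVal K B (fun _ => 1) N q = 1) (h0 : ∀ q ∈ B, 0 ≤ f q) (h1 : ∀ q ∈ B, f q ≤ 1)
    (q : Q) : hitVal K B f (N + 1) q = hitVal K B f N q := by
  have hle : hitVal K B (fun _ => 1) (N + 1) q ≤ 1 :=
    hitVal_le_of_superharmonic hK (h := fun _ => 1) (fun _ => zero_le_one)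
      (fun q => by simp [hsum]) (fun _ _ => le_rfl) _ q
  -- The values for `f` and for `1 - f` both grow with the number of steps, but their sum is already
  -- `1`; hence neither grows.
  have e : ∀ k, hitVal K B f k q + hitVal K B (fun q => 1 - f q) k q
      = hitVal K B (fun _ => 1) k q := by
    intro k
    rw [← hitVal_add]
    simp
  have a := hitVal_le_succ hK h0 N q
  have b := hitVal_le_succ (f := fun q => 1 - f q) hK (fun q hq => sub_nonneg.2 (h1 q hq)) N q
  have := e N
  have := e (N + 1)
  have := hN q
  linarith

end HitVal

/-! ### Reachability as a quotient of the outcomes of a single pass. -/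

section Renewal

variable {Q : Type*} [Fintype Q]

/-- A chain in which the starting state `q₀` or an absorbing state in `Z` is visited within `N`
steps reaches `z ∈ Z` with the probability that, given that the first visit is to `Z`, it is to
`z`. -/
lemma reachProb_eq_div [DecidableEq Q] (K : Q → PMF Q) (q₀ : Q) (Z : Set Q) (hq₀ : q₀ ∉ Z)
    (hZ : ∀ z ∈ Z, K z = PMF.pure z) (N : ℕ)
    (hN : ∀ q, hitVal (fun q q' => (K q q').toReal) (insert q₀ Z) (fun _ => 1) N q = 1)
    {z : Q} (hz : z ∈ Z) :
    reachProb K q₀ z = ENNReal.ofReal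
      (hitVal (fun q q' => (K q q').toReal) (insert q₀ Z) (Pi.single z 1) N q₀ /
        hitVal (fun q q' => (K q q').toReal) (insert q₀ Z) (Z.indicator 1) N q₀) := by
  classical
  set T : Q → Q → ℝ := fun q q' => (K q q').toReal with hT
  set B := insert q₀ Z with hBdef
  have hK : ∀ q q', 0 ≤ T q q' := fun _ _ => ENNReal.toReal_nonneg
  have hsum : ∀ q, ∑ q', T q q' = 1 := by
    intro q
    rw [hT, ← ENNReal.toReal_sum fun q' _ => PMF.apply_ne_top _ _, (K q).sum_coe_fintype,
      ENNReal.toReal_one]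
  have hTZ : ∀ y ∈ Z, ∀ g : Q → ℝ, ∑ q', T y q' * g q' = g y := by
    intro y hy g
    rw [Finset.sum_eq_single y]
    · simp [hT, hZ y hy]
    · intro q' _ hq'
      simp [hT, hZ y hy, PMF.pure_apply, hq']
    · simp
  have hne : q₀ ≠ z := fun h => hq₀ (h ▸ hz)
  set p := hitVal T B (Pi.single z 1) N q₀ with hp
  set d := hitVal T B (Z.indicator 1) N q₀ with hd
  have hp0 : 0 ≤ p := hitVal_nonneg hK (fun q _ => by
    by_cases h : q = z <;> simp [h]) N q₀
  have hpd : p ≤ d := hitVal_mono hK (fun q _ => by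
    by_cases h : q = z
    · subst h; simp [hz]
    · simp only [Pi.single_apply, h, if_false]
      exact Set.indicator_nonneg (fun _ _ => zero_le_one) q) N q₀
  have hr : hitVal T B (Pi.single q₀ 1) N q₀ = 1 - d := by
    rw [eq_sub_iff_add_eq, hd, ← hitVal_add]
    refine (hitVal_congr (fun q hq => ?_) N q₀).trans (hN q₀)
    rcases hq with rfl | hq
    · simp [hq₀]
    · have : q ≠ q₀ := fun h => hq₀ (h ▸ hq)
      simp [this, hq]
  have hcomb : ∀ c : ℝ, hitVal T B (fun q => (Pi.single z 1 : Q → ℝ) q +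
      c * (Pi.single q₀ 1 : Q → ℝ) q) N q₀ = p + c * (1 - d) := by
    intro c
    rw [hitVal_add, hitVal_const_mul, hr]
  have hd0 : 0 ≤ d := hp0.trans hpd
  -- If `d = 0` then `p = 0` too, in agreement with `0 / 0 = 0`.
  have hlam : p / d * d = p := by
    rcases hd0.eq_or_lt with h | h
    · have : p = 0 := le_antisymm (h ▸ hpd) hp0
      simp [this]
    · exact div_mul_cancel₀ p h.ne'
  have hlam0 : 0 ≤ p / d := div_nonneg hp0 hd0
  have hlam1 : p / d ≤ 1 := div_le_one_of_le₀ hpd hd0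
  have hfin : ∀ q, reachProb K q z ≠ ∞ := fun q =>
    ((reachProb_le_one K q z).trans_lt ENNReal.one_lt_top).ne
  apply le_antisymm
  · set f : Q → ℝ := fun q => (Pi.single z 1 : Q → ℝ) q + p / d * (Pi.single q₀ 1 : Q → ℝ) q
      with hf
    have hfz : f z = 1 := by simp [hf, Pi.single_apply, hne.symm]
    have hfq : f q₀ = p / d := by simp [hf, Pi.single_apply, hne]
    have hf01 : ∀ q, 0 ≤ f q ∧ f q ≤ 1 := by
      intro q
      by_cases h1 : q = z
      · subst h1; simp [hfz]
      · by_cases h2 : q = q₀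
        · subst h2; rw [hfq]; exact ⟨hlam0, hlam1⟩
        · simp [hf, Pi.single_apply, h1, h2]
    -- Upper bound: `g` has the value `p / d` at `q₀` and is harmonic, since `p + (p / d) * (1 - d)
    -- = p / d`; the reachability probability is the least such solution.
    set g : Q → ℝ := fun q => if q ∈ B then f q else hitVal T B f N q with hg
    have hg0 : ∀ q, 0 ≤ g q := by
      intro q
      simp only [hg]
      split_ifs
      · exact (hf01 q).1
      · exact hitVal_nonneg hK (fun q _ => (hf01 q).1) N q
    have hstep : ∀ q, ∑ q', T q q' * g q' = hitVal T B f N q := by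
      intro q
      rw [← hitVal_succ_eq hK hsum hN (fun q _ => (hf01 q).1) (fun q _ => (hf01 q).2)]
      refine Finset.sum_congr rfl fun q' _ => ?_
      by_cases hq : q' ∈ B <;> simp [hg, hq]
    have hq₀B : q₀ ∈ B := Set.mem_insert _ _
    have hharm : ∀ q, ∑ q', T q q' * g q' = g q := by
      intro q
      by_cases hq : q ∈ B
      · rcases hq with rfl | hq
        · rw [hstep, hcomb]
          simp only [hg, hq₀B, if_true, hfq]
          linarith
        · exact hTZ q hq g
      · rw [hstep]
        simp [hg, hq]
    have := reachProb_le K z (fun q => ENNReal.ofReal (g q))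
      (by simp [hg, hBdef, hz, hfz]) (fun q => by
        rw [← hharm q, ENNReal.ofReal_sum_of_nonneg fun q' _ => mul_nonneg (hK q q') (hg0 q')]
        refine Finset.sum_le_sum fun q' _ => ?_
        rw [ENNReal.ofReal_mul (hK q q'), hT, ENNReal.ofReal_toReal (PMF.apply_ne_top _ _)]) q₀
    simpa [hg, hq₀B, hfq] using this
  · set h : Q → ℝ := fun q => (reachProb K q z).toReal with hh
    have hh0 : ∀ q, 0 ≤ h q := fun _ => ENNReal.toReal_nonneg
    have hhz : h z = 1 := by
      simp only [hh]
      rw [reachProb_eq, if_pos rfl, ENNReal.toReal_one]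
    have hharm : ∀ q, ∑ q', T q q' * h q' ≤ h q := by
      intro q
      by_cases hq : q = z
      · subst hq
        exact (hTZ q hz h).le
      · simp only [hh]
        rw [reachProb_eq K q z, if_neg hq, ENNReal.toReal_sum fun q' _ =>
          ENNReal.mul_ne_top (PMF.apply_ne_top _ _) (hfin q')]
        simp [hT, ENNReal.toReal_mul]
    -- Lower bound: stopping the reachability probability `h` at the end of a pass gives `p + h q₀ *
    -- (1 - d) ≤ h q₀`, that is `p ≤ h q₀ * d`.
    have key := hitVal_le_of_superharmonic (B := B)
      (f := fun q => (Pi.single z 1 : Q → ℝ) q + h q₀ * (Pi.single q₀ 1 : Q → ℝ) q)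
      hK hh0 hharm (fun q _ => by
        by_cases h1 : q = z
        · subst h1; simp [hne.symm, hhz]
        · by_cases h2 : q = q₀
          · subst h2; simp [h1]
          · simpa [Pi.single_apply, h1, h2] using hh0 q) N q₀
    rw [hcomb] at key
    refine ENNReal.ofReal_le_of_le_toReal ?_
    rcases hd0.eq_or_lt with h' | h'
    · rw [← h', div_zero]; exact hh0 q₀
    · rw [div_le_iff₀ h']
      change p ≤ h q₀ * d
      linarith

end Renewal

/-! ## Optimizing over products of polytopes of distributions -/

section Polytope

variable {Q : Type*} [Fintype Q]

/-- The vectors with total mass one whose entries lie between prescribed bounds. -/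
def massBox (l u : Q → ℝ) : Set (Q → ℝ) := {x | (∀ q, x q ∈ Set.Icc (l q) (u q)) ∧ ∑ q, x q = 1}

lemma convex_massBox (l u : Q → ℝ) : Convex ℝ (massBox l u) := by
  rintro x ⟨hx, hx1⟩ y ⟨hy, hy1⟩ a b ha hb hab
  refine ⟨fun q => (convex_Icc (l q) (u q)) (hx q) (hy q) ha hb hab, ?_⟩
  simp only [Pi.add_apply, Pi.smul_apply, smul_eq_mul, Finset.sum_add_distrib, ← Finset.mul_sum,
    hx1, hy1, mul_one, hab]

lemma isCompact_massBox (l u : Q → ℝ) : IsCompact (massBox l u) := by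
  have hcl : IsClosed {x : Q → ℝ | ∑ q, x q = 1} :=
    isClosed_eq (continuous_finsetSum _ fun q _ => continuous_apply q) continuous_const
  have h := (isCompact_univ_pi fun q => isCompact_Icc (a := l q) (b := u q)).inter_right hcl
  convert h using 1
  ext x
  simp only [massBox, Set.mem_ofPred_eq, Set.mem_inter_iff, Set.mem_pi, Set.mem_univ, true_imp_iff]

open Classical in
/-- An extreme point has at most one entry strictly between the bounds. -/
lemma eq_or_eq_of_mem_extremePoints {l u : Q → ℝ} {x : Q → ℝ}
    (hx : x ∈ (massBox l u).extremePoints ℝ) {i j : Q} (hij : i ≠ j)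
    (hi : ¬(x i = l i ∨ x i = u i)) : x j = l j ∨ x j = u j := by
  by_contra hj
  push Not at hi hj
  obtain ⟨⟨hb, hs⟩, hex⟩ := hx
  have hli := lt_of_le_of_ne (hb i).1 hi.1.symm
  have hui := lt_of_le_of_ne (hb i).2 hi.2
  have hlj := lt_of_le_of_ne (hb j).1 hj.1.symm
  have huj := lt_of_le_of_ne (hb j).2 hj.2
  -- Mass `ε` can be moved between the entries `i` and `j` in both directions within the bounds, so
  -- `x` is the midpoint of two other points.
  set ε := min (min (x i - l i) (u i - x i)) (min (x j - l j) (u j - x j)) with hε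
  have hε0 : 0 < ε := by
    simp only [hε, lt_min_iff]
    exact ⟨⟨by linarith, by linarith⟩, by linarith, by linarith⟩
  have h1 : ε ≤ x i - l i := (min_le_left _ _).trans (min_le_left _ _)
  have h2 : ε ≤ u i - x i := (min_le_left _ _).trans (min_le_right _ _)
  have h3 : ε ≤ x j - l j := (min_le_right _ _).trans (min_le_left _ _)
  have h4 : ε ≤ u j - x j := (min_le_right _ _).trans (min_le_right _ _)
  have hmem : ∀ c : ℝ, |c| ≤ ε → x + c • (Pi.single i 1 - Pi.single j 1) ∈ massBox l u := by
    intro c hc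
    obtain ⟨hc1, hc2⟩ := abs_le.1 hc
    refine ⟨fun q => ?_, ?_⟩
    · by_cases hqi : q = i
      · subst hqi
        simp only [Pi.add_apply, Pi.smul_apply, Pi.sub_apply, Pi.single_eq_same,
          Pi.single_eq_of_ne hij, smul_eq_mul, sub_zero, mul_one, Set.mem_Icc]
        constructor <;> linarith
      · by_cases hqj : q = j
        · subst hqj
          simp only [Pi.add_apply, Pi.smul_apply, Pi.sub_apply, Pi.single_eq_same,
            Pi.single_eq_of_ne hqi, smul_eq_mul, zero_sub, mul_neg, mul_one, Set.mem_Icc]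
          constructor <;> linarith
        · simpa [hqi, hqj] using hb q
    · simp [Finset.sum_add_distrib, ← Finset.mul_sum, hs]
  have h := hex (hmem ε (abs_of_pos hε0).le) (hmem (-ε) (by rw [abs_neg, abs_of_pos hε0]))
    ⟨1 / 2, 1 / 2, by norm_num, by norm_num, by norm_num, by
      ext q
      simp only [Pi.add_apply, Pi.smul_apply, smul_eq_mul]
      ring⟩
  have := congrFun h i
  simp only [Pi.add_apply, Pi.smul_apply, Pi.sub_apply, Pi.single_eq_same,
    Pi.single_eq_of_ne hij, smul_eq_mul, sub_zero, mul_one] at this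
  linarith

/-- All entries but at most one sit at a bound, and the remaining one is determined by the total
mass. -/
lemma finite_extremePoints_massBox (l u : Q → ℝ) : ((massBox l u).extremePoints ℝ).Finite := by
  classical
  let V : Set (Q → ℝ) := Set.univ.pi fun q => {l q, u q}
  have hV : V.Finite := Set.Finite.pi fun q => Set.toFinite _
  have hfin : (⋃ j : Q, (fun y : Q → ℝ => Function.update y j
      (1 - ∑ i ∈ Finset.univ.erase j, y i)) '' V).Finite :=
    Set.finite_iUnion fun j => hV.image _
  refine (hfin.union hV).subset fun x hx => ?_
  by_cases h : ∃ j, ¬(x j = l j ∨ x j = u j)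
  · obtain ⟨j, hj⟩ := h
    refine Or.inl (Set.mem_iUnion.2 ⟨j, ⟨Function.update x j (l j), ?_, ?_⟩⟩)
    · intro i _
      by_cases hij : i = j
      · subst hij; simp
      · have := eq_or_eq_of_mem_extremePoints hx (Ne.symm hij) hj
        simpa [hij] using this
    · have hs : ∑ i ∈ Finset.univ.erase j, Function.update x j (l j) i
          = ∑ i ∈ Finset.univ.erase j, x i :=
        Finset.sum_congr rfl fun i hi => by simp [Finset.ne_of_mem_erase hi]
      have hx1 := hx.1.2
      rw [← Finset.add_sum_erase _ _ (Finset.mem_univ j)] at hx1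
      simp only [hs, Function.update_idem]
      rw [← hx1, add_sub_cancel_right, Function.update_eq_self]
  · push Not at h
    exact Or.inr fun q _ => by simpa using h q

/-- A finite-dimensional box intersected with the hyperplane of total mass one has finitely many
vertices. -/
lemma exists_finite_convexHull_eq_massBox (l u : Q → ℝ) :
    ∃ E : Set (Q → ℝ), E.Finite ∧ convexHull ℝ E = massBox l u := by
  refine ⟨_, finite_extremePoints_massBox l u, ?_⟩
  -- Krein–Milman; no closure is needed because the hull of a finite set is closed.
  exact ((finite_extremePoints_massBox l u).isClosed_convexHull ℝ).closure_eq.symm.trans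
    (closure_convexHull_extremePoints (isCompact_massBox l u) (convex_massBox l u))

end Polytope

/-! ### Quotients of affine functions on a polytope. -/

section LinearFractional

variable {V : Type*} [AddCommGroup V] [Module ℝ V]

/-- A function on a convex set that preserves convex combinations. -/
def IsAffineOn (R : Set V) (F : V → ℝ) : Prop :=
  ∀ x ∈ R, ∀ y ∈ R, ∀ a b : ℝ, 0 ≤ a → 0 ≤ b → a + b = 1 → F (a • x + b • y) = a * F x + b * F y

variable {E R : Set V} {F G : V → ℝ}

/-- With `c` the largest quotient at a vertex, `F ≤ c * G` is a convex condition that holds at the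
vertices, hence everywhere. No sign of `F` is assumed, so that the lemma also yields minima through
`-F`. -/
lemma IsAffineOn.exists_le_div (hF : IsAffineOn R F) (hG : IsAffineOn R G) (hE : E.Finite)
    (hER : convexHull ℝ E = R) (hG0 : ∀ x ∈ R, 0 ≤ G x) (hFG : ∀ x ∈ R, G x = 0 → F x = 0)
    {x : V} (hx : x ∈ R) : ∃ y ∈ E, F x / G x ≤ F y / G y := by
  have hsub : E ⊆ R := hER ▸ subset_convexHull ℝ E
  have hconv : Convex ℝ R := hER ▸ convex_convexHull ℝ E
  have hne : E.Nonempty := convexHull_nonempty_iff.1 ⟨x, hER ▸ hx⟩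
  obtain ⟨y, hy, hmax⟩ := hE.exists_maximalFor (fun y => F y / G y) E hne
  refine ⟨y, hy, ?_⟩
  have hmax' : ∀ z ∈ E, F z / G z ≤ F y / G y := fun z hz => by
    rcases le_total (F z / G z) (F y / G y) with h | h
    · exact h
    · exact hmax hz h
  set c := F y / G y with hc
  have hC : Convex ℝ {z ∈ R | F z ≤ c * G z} := by
    rintro p ⟨hp, hp'⟩ q ⟨hq, hq'⟩ a b ha hb hab
    refine ⟨hconv hp hq ha hb hab, ?_⟩
    rw [hF p hp q hq a b ha hb hab, hG p hp q hq a b ha hb hab]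
    nlinarith [mul_le_mul_of_nonneg_left hp' ha, mul_le_mul_of_nonneg_left hq' hb]
  have hEC : E ⊆ {z ∈ R | F z ≤ c * G z} := by
    intro z hz
    refine ⟨hsub hz, ?_⟩
    rcases (hG0 z (hsub hz)).eq_or_lt with h | h
    · rw [hFG z (hsub hz) h.symm, ← h, mul_zero]
    · exact (div_le_iff₀ h).1 (hmax' z hz)
  have hxC := (convexHull_min hEC hC) (hER.symm ▸ hx)
  rcases (hG0 x hx).eq_or_lt with h | h
  · obtain ⟨z, hz⟩ := hne
    rw [← h, div_zero]
    -- At a point with `G x = 0` the quotient is `0`. If all vertex quotients were negative, `G`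
    -- would be positive at every vertex, hence on the whole hull.
    by_contra hneg
    push Not at hneg
    have hall : ∀ z ∈ E, 0 < G z := by
      intro z hz
      refine (hG0 z (hsub hz)).lt_of_ne fun h0 => ?_
      have := hmax' z hz
      rw [← h0, div_zero] at this
      linarith
    have hC' : Convex ℝ {z ∈ R | 0 < G z} := by
      rintro p ⟨hp, hp'⟩ q ⟨hq, hq'⟩ a b ha hb hab
      refine ⟨hconv hp hq ha hb hab, ?_⟩
      rw [hG p hp q hq a b ha hb hab]
      rcases ha.eq_or_lt with rfl | ha
      · have : b = 1 := by linarith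
        subst this; linarith
      · have := mul_pos ha hp'
        have := mul_nonneg hb hq'.le
        linarith
    have := (convexHull_min (fun z hz => (⟨hsub hz, hall z hz⟩ : z ∈ {z ∈ R | 0 < G z})) hC')
      (hER.symm ▸ hx)
    exact absurd h this.2.ne
  · exact (div_le_iff₀ h).2 hxC.2

end LinearFractional

/-! ### Maximization one coordinate at a time. -/

section Product

variable {ι V : Type*} [Fintype ι] [DecidableEq ι]

/-- If a function on a product of sets can always be increased by moving one entry into a finite
set, it attains its maximum. -/
lemma exists_forall_le_of_update {R E : ι → Set V} (hE : ∀ i, (E i).Finite)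
    (hER : ∀ i, E i ⊆ R i) (hR : ∀ i, (R i).Nonempty) (v : (ι → V) → ℝ)
    (h : ∀ K, (∀ i, K i ∈ R i) → ∀ i, ∃ y ∈ E i, v K ≤ v (Function.update K i y)) :
    ∃ K, (∀ i, K i ∈ R i) ∧ ∀ K', (∀ i, K' i ∈ R i) → v K' ≤ v K := by
  have step : ∀ (s : Finset ι) (K : ι → V), (∀ i, K i ∈ R i) →
      ∃ K', (∀ i, K' i ∈ R i) ∧ (∀ i ∈ s, K' i ∈ E i) ∧ v K ≤ v K' := by
    intro s
    induction s using Finset.induction_on with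
    | empty => exact fun K hK => ⟨K, hK, by simp, le_rfl⟩
    | insert j s hj ih =>
      intro K hK
      obtain ⟨K₁, h1, h2, h3⟩ := ih K hK
      obtain ⟨y, hy, hle⟩ := h K₁ h1 j
      refine ⟨Function.update K₁ j y, fun i => ?_, fun i hi => ?_, h3.trans hle⟩
      · by_cases hij : i = j
        · subst hij; simpa using hER i hy
        · simpa [hij] using h1 i
      · by_cases hij : i = j
        · subst hij; simpa using hy
        · simpa [hij] using h2 i (Finset.mem_of_mem_insert_of_ne hi hij)
  have hfin : (Set.univ.pi E).Finite := Set.Finite.pi hE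
  choose K₀ hK₀ using hR
  -- `step` shows that the finite product of the `E i` is nonempty, and later moves an arbitrary
  -- competitor into it without decreasing `v`.
  obtain ⟨K₁, -, hK₁, -⟩ := step Finset.univ K₀ hK₀
  obtain ⟨K, hK, hmax⟩ := Set.exists_max_image _ v hfin ⟨K₁, fun i _ => hK₁ i (Finset.mem_univ i)⟩
  refine ⟨K, fun i => hER i (hK i trivial), fun K' hK' => ?_⟩
  obtain ⟨K₂, -, h2, h3⟩ := step Finset.univ K' hK'
  exact h3.trans (hmax K₂ fun i _ => h2 i (Finset.mem_univ i))

end Product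

/-! ### Matrices for which no row is used twice within a pass. -/

section Layered

variable {Q : Type*} [Fintype Q]

/-- Outside of `B`, transitions strictly decrease the rank `ℓ`. -/
def IsLayered (K : Q → Q → ℝ) (B : Set Q) (ℓ : Q → ℕ) : Prop :=
  ∀ q q', q' ∉ B → ℓ q ≤ ℓ q' → K q q' = 0

variable {K K' : Q → Q → ℝ} {B : Set Q} {ℓ : Q → ℕ} {f : Q → ℝ}

/-- Until it stops, a pass from rank below `m` stays below `m`, so it never consults the other rows.
-/
lemma IsLayered.hitVal_congr (hK : IsLayered K B ℓ) {m : ℕ}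
    (h : ∀ q, ℓ q < m → K q = K' q) (k : ℕ) (q : Q) (hq : ℓ q < m) :
    hitVal K B f k q = hitVal K' B f k q := by
  induction k generalizing q with
  | zero => rfl
  | succ k ih =>
    simp only [hitVal, ← h q hq]
    refine Finset.sum_congr rfl fun q' _ => ?_
    by_cases hB : q' ∈ B
    · simp [hB]
    · rcases Nat.lt_or_ge (ℓ q') (ℓ q) with hlt | hge
      · rw [ih q' (hlt.trans hq)]
      · simp [hK q q' hB hge]

/-- The rank drops at each step outside `B`, so `B` is entered after at most `ℓ q + 1` steps. -/
lemma IsLayered.hitVal_one (hK : IsLayered K B ℓ) (hsum : ∀ q, ∑ q', K q q' = 1)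
    (k : ℕ) (q : Q) (hq : ℓ q < k) : hitVal K B (fun _ => 1) k q = 1 := by
  induction k generalizing q with
  | zero => exact absurd hq (Nat.not_lt_zero _)
  | succ k ih =>
    refine Eq.trans (Finset.sum_congr rfl fun q' _ => ?_) (hsum q)
    by_cases hB : q' ∈ B
    · simp [hB]
    · rcases Nat.lt_or_ge (ℓ q') (ℓ q) with hlt | hge
      · simp [hB, ih q' (by lia)]
      · simp [hK q q' hB hge]

/-- The value at the first return is affine in each row of a layered matrix. -/
lemma isAffineOn_hitVal_update [DecidableEq Q] (j : Q) {R : Set (Q → ℝ)}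
    (hK : ∀ x ∈ R, IsLayered (Function.update K j x) B ℓ) (hR : Convex ℝ R) (k : ℕ) (q : Q) :
    IsAffineOn R fun x => hitVal (Function.update K j x) B f k q := by
  intro x hx y hy a b ha hb hab
  have hz := hR hx hy ha hb hab
  set z := a • x + b • y with hzdef
  show hitVal (Function.update K j z) B f k q = a * hitVal (Function.update K j x) B f k q
    + b * hitVal (Function.update K j y) B f k q
  induction k generalizing q with
  | zero => simp [hitVal]
  | succ k ih =>
    simp only [hitVal, Finset.mul_sum, ← Finset.sum_add_distrib]
    refine Finset.sum_congr rfl fun q' _ => ?_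
    by_cases hqj : q = j
    · subst hqj
      simp only [Function.update_self]
      have hzq : z q' = a * x q' + b * y q' := rfl
      by_cases hB : q' ∈ B
      · simp only [hB, if_true, hzq]
        ring
      · simp only [hB, if_false]
        rcases Nat.lt_or_ge (ℓ q') (ℓ q) with hlt | hge
        · have hagree : ∀ u v : Q → ℝ, ∀ p, ℓ p < ℓ q →
              Function.update K q u p = Function.update K q v p := by
            intro u v p hp
            have : p ≠ q := fun h => absurd hp (h ▸ lt_irrefl _)
            simp [this]
          rw [(hK x hx).hitVal_congr (hagree x z) k q' hlt,
            (hK y hy).hitVal_congr (hagree y z) k q' hlt, hzq]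
          ring
        · have h1 := hK x hx q q' hB hge
          have h2 := hK y hy q q' hB hge
          rw [Function.update_self] at h1 h2
          rw [hzq, h1, h2]
          ring
    · simp only [Function.update_of_ne hqj]
      split_ifs with hB
      · rw [← add_mul, hab, one_mul]
      · rw [ih]
        ring

variable {l u : Q → Q → ℝ} {g : Q → ℝ}

/-- Over a product of polytopes of distributions, quotients of values at the first return are
maximal for some matrix. -/
lemma exists_forall_hitVal_div_le (hl : ∀ q q', 0 ≤ l q q')
    (hlay : ∀ K : Q → Q → ℝ, (∀ q, K q ∈ massBox (l q) (u q)) → IsLayered K B ℓ)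
    (hne : ∀ q, (massBox (l q) (u q)).Nonempty) (hg : ∀ q ∈ B, 0 ≤ g q)
    (c : ℝ) (hfg : ∀ q ∈ B, |f q| ≤ c * g q) (k : ℕ) (q₀ : Q) :
    ∃ K, (∀ q, K q ∈ massBox (l q) (u q)) ∧ ∀ K', (∀ q, K' q ∈ massBox (l q) (u q)) →
      hitVal K' B f k q₀ / hitVal K' B g k q₀ ≤ hitVal K B f k q₀ / hitVal K B g k q₀ := by
  classical
  choose E hE hEeq using fun q => exists_finite_convexHull_eq_massBox (l q) (u q)
  refine exists_forall_le_of_update hE (fun q => hEeq q ▸ subset_convexHull ℝ (E q)) hne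
    (fun K => hitVal K B f k q₀ / hitVal K B g k q₀) fun K hK j => ?_
  have hupd : ∀ x ∈ massBox (l j) (u j), ∀ q, Function.update K j x q ∈ massBox (l q) (u q) := by
    intro x hx q
    by_cases hq : q = j
    · subst hq; simpa using hx
    · simpa [hq] using hK q
  have hpos : ∀ x ∈ massBox (l j) (u j), ∀ q q', 0 ≤ Function.update K j x q q' :=
    fun x hx q q' => (hl q q').trans ((hupd x hx q).1 q').1
  have hlay' : ∀ x ∈ massBox (l j) (u j), IsLayered (Function.update K j x) B ℓ :=
    fun x hx => hlay _ (hupd x hx)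
  have hF := isAffineOn_hitVal_update (f := f) j hlay' (convex_massBox _ _) k q₀
  have hG := isAffineOn_hitVal_update (f := g) j hlay' (convex_massBox _ _) k q₀
  obtain ⟨y, hy, hle⟩ := hF.exists_le_div hG (hE j) (hEeq j)
    (fun x hx => hitVal_nonneg (hpos x hx) hg k q₀)
    -- The bound `|f| ≤ c * g` passes to the values, so the numerator vanishes with the denominator.
    (fun x hx h0 => by
      have h1 := hitVal_mono (B := B) (hpos x hx) (fun q hq => (abs_le.1 (hfg q hq)).2) k q₀
      have h2 := hitVal_mono (B := B) (f := fun q => -c * g q) (g := f) (hpos x hx)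
        (fun q hq => by linarith [(abs_le.1 (hfg q hq)).1]) k q₀
      rw [hitVal_const_mul, h0] at h1 h2
      linarith) (hK j)
  rw [Function.update_eq_self] at hle
  exact ⟨y, hy, hle⟩

lemma exists_forall_le_hitVal_div (hl : ∀ q q', 0 ≤ l q q')
    (hlay : ∀ K : Q → Q → ℝ, (∀ q, K q ∈ massBox (l q) (u q)) → IsLayered K B ℓ)
    (hne : ∀ q, (massBox (l q) (u q)).Nonempty) (hg : ∀ q ∈ B, 0 ≤ g q)
    (c : ℝ) (hfg : ∀ q ∈ B, |f q| ≤ c * g q) (k : ℕ) (q₀ : Q) :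
    ∃ K, (∀ q, K q ∈ massBox (l q) (u q)) ∧ ∀ K', (∀ q, K' q ∈ massBox (l q) (u q)) →
      hitVal K B f k q₀ / hitVal K B g k q₀ ≤ hitVal K' B f k q₀ / hitVal K' B g k q₀ := by
  obtain ⟨K, hK, hmax⟩ := exists_forall_hitVal_div_le (f := fun q => -1 * f q) hl hlay hne hg c
    (fun q hq => by simpa using hfg q hq) k q₀
  refine ⟨K, hK, fun K' hK' => ?_⟩
  have := hmax K' hK'
  rw [hitVal_const_mul, hitVal_const_mul, neg_one_mul, neg_one_mul, neg_div, neg_div] at this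
  linarith

end Layered

/-! ## The transient probabilities -/

section MatrixExp

variable {S : Type*} [Fintype S] [DecidableEq S]

open scoped Matrix.Norms.Operator in
lemma Matrix.hasDerivAt_exp_smul_apply (A : Matrix S S ℝ) (t : ℝ) (s a : S) :
    HasDerivAt (fun u : ℝ => NormedSpace.exp (u • A) s a)
      ((NormedSpace.exp (t • A) * A) s a) t := by
  have h := hasDerivAt_exp_smul_const (𝕂 := ℝ) A t
  exact (hasDerivAt_pi.1 ((hasDerivAt_pi.1 h) s)) a

open scoped Matrix.Norms.Operator in
lemma Matrix.hasDerivAt_exp_smul_apply' (A : Matrix S S ℝ) (t : ℝ) (s a : S) :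
    HasDerivAt (fun u : ℝ => NormedSpace.exp (u • A) s a)
      ((A * NormedSpace.exp (t • A)) s a) t := by
  have h := hasDerivAt_exp_smul_const' (𝕂 := ℝ) A t
  exact (hasDerivAt_pi.1 ((hasDerivAt_pi.1 h) s)) a

open scoped Matrix.Norms.Operator in
lemma Matrix.hasSum_exp (A : Matrix S S ℝ) :
    HasSum (fun n : ℕ => (n.factorial : ℝ)⁻¹ • A ^ n) (NormedSpace.exp A) :=
  NormedSpace.exp_series_hasSum_exp' (𝕂 := ℝ) A

lemma Matrix.hasSum_exp_apply (A : Matrix S S ℝ) (s a : S) :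
    HasSum (fun n : ℕ => ((n.factorial : ℝ)⁻¹ • A ^ n) s a) (NormedSpace.exp A s a) := by
  have h := Matrix.hasSum_exp A
  exact (Pi.hasSum.1 ((Pi.hasSum.1 h) s)) a

lemma Matrix.exp_apply_nonneg {A : Matrix S S ℝ} (hA : ∀ s a, 0 ≤ A s a) (s a : S) :
    0 ≤ NormedSpace.exp A s a := by
  have hpow : ∀ (n : ℕ) (s a : S), 0 ≤ (A ^ n) s a := by
    intro n
    induction n with
    | zero =>
      intro s a
      rw [pow_zero, Matrix.one_apply]
      split_ifs <;> norm_num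
    | succ n ih =>
      intro s a
      rw [pow_succ, Matrix.mul_apply]
      exact Finset.sum_nonneg fun b _ => mul_nonneg (ih s b) (hA b a)
  exact (Matrix.hasSum_exp_apply A s a).nonneg fun n =>
    mul_nonneg (by positivity) (hpow n s a)

/-- The exponential of a matrix with nonnegative off-diagonal entries has nonnegative entries. -/
lemma Matrix.exp_apply_nonneg_of_offDiag {A : Matrix S S ℝ} (hA : ∀ s a, s ≠ a → 0 ≤ A s a)
    (s a : S) : 0 ≤ NormedSpace.exp A s a := by
  -- Adding `c` to the diagonal makes all entries nonnegative. The shift is a scalar matrix, so it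
  -- commutes and contributes only the positive factor `exp (-c)`.
  set c : ℝ := ∑ b, |A b b| with hc
  have hdec : A = (A + Matrix.diagonal fun _ => c) + Matrix.diagonal fun _ => -c := by
    ext i j
    by_cases hij : i = j
    · subst hij; simp
    · simp [hij]
  have hcomm : Commute (A + Matrix.diagonal fun _ => c) (Matrix.diagonal fun _ : S => -c) := by
    have : (Matrix.diagonal fun _ : S => -c) = (-c) • (1 : Matrix S S ℝ) := by
      rw [Matrix.smul_one_eq_diagonal]
    rw [this]
    exact (Commute.one_right _).smul_right _
  have hnn : ∀ i j, 0 ≤ (A + Matrix.diagonal fun _ => c : Matrix S S ℝ) i j := by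
    intro i j
    by_cases hij : i = j
    · subst hij
      have h1 := Finset.single_le_sum (f := fun b => |A b b|) (fun b _ => abs_nonneg _)
        (Finset.mem_univ i)
      have h2 := neg_abs_le (A i i)
      simp only [Matrix.add_apply, Matrix.diagonal_apply_eq]
      linarith
    · simpa [hij] using hA i j hij
  rw [hdec, Matrix.exp_add_of_commute _ _ hcomm, Matrix.exp_diagonal, Matrix.mul_diagonal,
    Pi.coe_exp, ← Real.exp_eq_exp_ℝ]
  exact mul_nonneg (Matrix.exp_apply_nonneg hnn s a) (Real.exp_pos _).le

end MatrixExp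

namespace CTMC

lemma generator_apply {S C : Type*} (M : CTMC S C) [DecidableEq S] (s a : S) :
    M.generator s a = (M.jump s a).toReal * M.rate s - if s = a then (M.rate s : ℝ) else 0 := by
  simp [generator, Matrix.diagonal_apply]

variable {S C : Type*} [Fintype S] (M : CTMC S C)

lemma sum_jump_toReal (s : S) : ∑ a, (M.jump s a).toReal = 1 := by
  rw [← ENNReal.toReal_sum fun a _ => PMF.apply_ne_top _ _, PMF.sum_coe_fintype,
    ENNReal.toReal_one]

lemma sum_generator [DecidableEq S] (s : S) : ∑ a, M.generator s a = 0 := by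
  simp [generator_apply, ← Finset.sum_mul, sum_jump_toReal]

lemma transient_zero [DecidableEq S] (s a : S) : M.transient 0 s a = if s = a then 1 else 0 := by
  simp only [transient, zero_smul, NormedSpace.exp_zero, Matrix.one_apply]
  congr

lemma transient_nonneg {t : ℝ} (ht : 0 ≤ t) (s a : S) : 0 ≤ M.transient t s a := by
  classical
  refine Matrix.exp_apply_nonneg_of_offDiag (fun s a hsa => ?_) s a
  rw [Matrix.smul_apply, generator_apply, if_neg hsa, sub_zero, smul_eq_mul]
  exact mul_nonneg ht (mul_nonneg ENNReal.toReal_nonneg (NNReal.coe_nonneg _))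

lemma hasDerivAt_transient (t : ℝ) (s a : S) :
    HasDerivAt (fun u => M.transient u s a)
      (M.rate s * ∑ b, (M.jump s b).toReal * M.transient t b a - M.rate s * M.transient t s a)
      t := by
  classical
  have h := Matrix.hasDerivAt_exp_smul_apply' M.generator t s a
  have e : (M.generator * NormedSpace.exp (t • M.generator)) s a
      = M.rate s * ∑ b, (M.jump s b).toReal * M.transient t b a
        - M.rate s * M.transient t s a := by
    simp only [Matrix.mul_apply, generator_apply, sub_mul, Finset.sum_sub_distrib, ite_mul,
      zero_mul, Finset.sum_ite_eq, Finset.mem_univ, if_true, Finset.mul_sum]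
    congr 1
    · refine Finset.sum_congr rfl fun b _ => ?_
      simp only [transient]
      convert (by ring : (M.jump s b).toReal * (M.rate s : ℝ) *
        NormedSpace.exp (t • M.generator) b a = M.rate s * ((M.jump s b).toReal *
        NormedSpace.exp (t • M.generator) b a))
  rw [← e]
  simp only [transient]
  convert h

/-- The derivative of the row sum is `0` because the rows of the generator sum to `0`; at time `0`
the sum is `1`. -/
lemma sum_transient (t : ℝ) (s : S) : ∑ a, M.transient t s a = 1 := by
  classical
  have hd : ∀ u, HasDerivAt (fun u => ∑ a, M.transient u s a) 0 u := by
    intro u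
    have h : HasDerivAt (fun u => ∑ a, NormedSpace.exp (u • M.generator) s a)
        (∑ a, (NormedSpace.exp (u • M.generator) * M.generator) s a) u :=
      HasDerivAt.fun_sum fun a _ => Matrix.hasDerivAt_exp_smul_apply M.generator u s a
    have e : ∑ a, (NormedSpace.exp (u • M.generator) * M.generator) s a = 0 := by
      simp only [Matrix.mul_apply]
      rw [Finset.sum_comm]
      simp [← Finset.mul_sum, sum_generator]
    rw [e] at h
    simp only [transient]
    convert h
  have hconst := is_const_of_deriv_eq_zero (fun u => (hd u).differentiableAt)
    (fun u => (hd u).deriv) t 0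
  rw [hconst]
  simp [transient_zero]

lemma continuous_transient (s a : S) : Continuous fun t => M.transient t s a :=
  continuous_iff_continuousAt.2 fun t => (M.hasDerivAt_transient t s a).continuousAt

lemma transient_le_one {t : ℝ} (ht : 0 ≤ t) (s a : S) : M.transient t s a ≤ 1 :=
  (Finset.single_le_sum (fun b _ => M.transient_nonneg ht s b) (Finset.mem_univ a)).trans_eq
    (M.sum_transient t s)

/-- Kolmogorov's backward equation in integrated form. -/
lemma transient_eq_add_integral [DecidableEq S] (t : ℝ) (s a : S) :
    M.transient t s a = (if s = a then Real.exp (-(M.rate s * t)) else 0) +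
      ∫ u in (0 : ℝ)..t, M.rate s * Real.exp (-(M.rate s * u)) *
        ∑ b, (M.jump s b).toReal * M.transient (t - u) b a := by
  -- In `exp (-(r * u)) * transient (t - u)` the terms with the exit rate cancel by the backward
  -- equation, and only the jump term remains.
  have hderiv : ∀ u ∈ Set.uIcc 0 t,
      HasDerivAt (fun u => Real.exp (-(M.rate s * u)) * M.transient (t - u) s a)
        (-(M.rate s * Real.exp (-(M.rate s * u)) *
          ∑ b, (M.jump s b).toReal * M.transient (t - u) b a)) u := by
    intro u _
    have h1 : HasDerivAt (fun u : ℝ => Real.exp (-(M.rate s * u)))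
        (Real.exp (-(M.rate s * u)) * (-(M.rate s * 1))) u :=
      (((hasDerivAt_id u).const_mul _).neg).exp
    have h2 := (M.hasDerivAt_transient (t - u) s a).comp u ((hasDerivAt_id u).const_sub t)
    refine (h1.mul h2).congr_deriv ?_
    simp only [Function.comp]
    ring
  have hint : IntervalIntegrable (fun u => -(M.rate s * Real.exp (-(M.rate s * u)) *
      ∑ b, (M.jump s b).toReal * M.transient (t - u) b a)) volume 0 t := by
    refine Continuous.intervalIntegrable ?_ _ _
    refine Continuous.neg (Continuous.mul (by fun_prop) (continuous_finsetSum _ fun b _ => ?_))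
    exact continuous_const.mul ((M.continuous_transient b a).comp (by fun_prop))
  have h := intervalIntegral.integral_eq_sub_of_hasDerivAt hderiv hint
  rw [intervalIntegral.integral_neg, sub_self, sub_zero, mul_zero, neg_zero, Real.exp_zero,
    one_mul, transient_zero] at h
  have h' : (if s = a then Real.exp (-(M.rate s * t)) else 0)
      = Real.exp (-(M.rate s * t)) * if s = a then 1 else 0 := by
    split_ifs <;> ring
  rw [h']
  linarith

end CTMC

/-! ## Residence times -/

section Residence

lemma lintegral_residenceLaw {r : ℝ≥0} (hr : r ≠ 0) {g : ℝ≥0∞ → ℝ≥0∞} (hg : Measurable g) :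
    ∫⁻ τ, g τ ∂residenceLaw r
      = ∫⁻ x in Set.Ioi (0 : ℝ), ENNReal.ofReal (r * Real.exp (-(r * x))) *
        g (ENNReal.ofReal x) := by
  have hm : Measurable fun x => exponentialPDF (r : ℝ) x :=
    (measurable_exponentialPDFReal _).ennreal_ofReal
  rw [residenceLaw, if_neg hr, lintegral_map hg ENNReal.measurable_ofReal]
  change ∫⁻ x, g (ENNReal.ofReal x) ∂(volume.withDensity fun x => exponentialPDF (r : ℝ) x) = _
  rw [lintegral_withDensity_eq_lintegral_mul _ hm (g := fun x => g (ENNReal.ofReal x)) (hg.comp ENNReal.measurable_ofReal),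
    ← Measure.restrict_congr_set Ioi_ae_eq_Ici.symm, ← lintegral_indicator measurableSet_Ici]
  refine lintegral_congr fun x => ?_
  by_cases hx : 0 ≤ x
  · rw [Set.indicator_of_mem (Set.mem_Ici.2 hx), Pi.mul_apply, exponentialPDF_of_nonneg hx]
  · rw [Set.indicator_of_notMem (fun h => hx (Set.mem_Ici.1 h)), Pi.mul_apply,
      exponentialPDF_of_neg (not_le.1 hx), zero_mul]

/-- Residence times are memoryless. -/
lemma setLIntegral_residenceLaw_Ioi (r : ℝ≥0) {t : ℝ≥0∞} (ht : t ≠ ∞) {g : ℝ≥0∞ → ℝ≥0∞}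
    (hg : Measurable g) :
    ∫⁻ τ in Set.Ioi t, g τ ∂residenceLaw r
      = ENNReal.ofReal (Real.exp (-(r * t.toReal))) * ∫⁻ τ, g (τ + t) ∂residenceLaw r := by
  by_cases hr : r = 0
  · subst hr
    rw [residenceLaw, if_pos rfl, ← lintegral_indicator measurableSet_Ioi, lintegral_dirac,
      lintegral_dirac, Set.indicator_of_mem (Set.mem_Ioi.2 ht.lt_top)]
    simp
  rw [← lintegral_indicator measurableSet_Ioi,
    lintegral_residenceLaw hr (hg.indicator measurableSet_Ioi),
    lintegral_residenceLaw hr (g := fun τ => g (τ + t)) (hg.comp (measurable_id.add_const t)),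
    ← lintegral_const_mul _ (by fun_prop), ← lintegral_indicator measurableSet_Ioi,
    ← lintegral_indicator measurableSet_Ioi, ← lintegral_add_right_eq_self _ t.toReal]
  refine lintegral_congr fun x => ?_
  by_cases hx : 0 < x
  · have h1 : 0 < x + t.toReal := by positivity
    have h2 : ENNReal.ofReal (x + t.toReal) = ENNReal.ofReal x + t := by
      rw [ENNReal.ofReal_add hx.le ENNReal.toReal_nonneg, ENNReal.ofReal_toReal ht]
    have h3 : t < ENNReal.ofReal x + t := by
      rw [add_comm]
      exact ENNReal.lt_add_right ht (ENNReal.ofReal_pos.2 hx).ne'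
    rw [Set.indicator_of_mem (Set.mem_Ioi.2 hx), Set.indicator_of_mem (Set.mem_Ioi.2 h1), h2,
      Set.indicator_of_mem (Set.mem_Ioi.2 h3), ← mul_assoc, ← ENNReal.ofReal_mul (by positivity)]
    congr 2
    rw [show -((r : ℝ) * (x + t.toReal)) = -(r * t.toReal) + -(r * x) by ring, Real.exp_add]
    ring
  · rw [Set.indicator_of_notMem (fun h => hx (Set.mem_Ioi.1 h))]
    by_cases h1 : 0 < x + t.toReal
    · rw [Set.indicator_of_mem (Set.mem_Ioi.2 h1), Set.indicator_of_notMem, mul_zero]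
      rw [Set.mem_Ioi, not_lt]
      exact ENNReal.ofReal_le_of_le_toReal (by linarith)
    · rw [Set.indicator_of_notMem (fun h => h1 (Set.mem_Ioi.1 h))]

/-- The Laplace transform of residence times at `1`. -/
lemma setLIntegral_residenceLaw_exp_le (r : ℝ≥0) {t : ℝ≥0∞} (ht : t ≠ ∞) :
    ∫⁻ τ in Set.Iic t, ENNReal.ofReal (Real.exp (-τ.toReal)) ∂residenceLaw r
      ≤ ENNReal.ofReal (r / (r + 1)) := by
  -- For rate `0` the mass sits at `∞`, where the integrand would be `1` because `∞.toReal = 0`;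
  -- restricting to `Set.Iic t` removes it.
  by_cases hr : r = 0
  · subst hr
    rw [residenceLaw, if_pos rfl, ← lintegral_indicator measurableSet_Iic, lintegral_dirac,
      Set.indicator_of_notMem (by simpa using ht)]
    simp
  have hm : Measurable fun τ : ℝ≥0∞ => ENNReal.ofReal (Real.exp (-τ.toReal)) := by fun_prop
  refine (setLIntegral_le_lintegral _ _).trans ?_
  rw [lintegral_residenceLaw hr hm]
  -- The integrand is `r / (r + 1)` times the exponential density of rate `r + 1`, which is
  -- normalized.
  have h1 : ∫⁻ τ, 1 ∂residenceLaw (r + 1) = 1 := by simp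
  rw [lintegral_residenceLaw (by positivity) measurable_const] at h1
  calc ∫⁻ x in Set.Ioi (0 : ℝ), ENNReal.ofReal (r * Real.exp (-(r * x))) *
        ENNReal.ofReal (Real.exp (-(ENNReal.ofReal x).toReal))
      = ∫⁻ x in Set.Ioi (0 : ℝ), ENNReal.ofReal (r / (r + 1)) *
        (ENNReal.ofReal ((r + 1 : ℝ≥0) * Real.exp (-((r + 1 : ℝ≥0) * x))) * 1) := by
        refine setLIntegral_congr_fun measurableSet_Ioi fun x hx => ?_
        have hx' : 0 < x := hx
        simp only [ENNReal.toReal_ofReal hx'.le, mul_one]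
        rw [← ENNReal.ofReal_mul (by positivity), ← ENNReal.ofReal_mul (by positivity)]
        congr 1
        push_cast
        rw [show -(((r : ℝ) + 1) * x) = -(r * x) + -x by ring, Real.exp_add]
        have : (r : ℝ) + 1 ≠ 0 := by positivity
        field_simp
    _ = ENNReal.ofReal (r / (r + 1)) := by
        rw [lintegral_const_mul _ (by fun_prop), h1, mul_one]
    _ ≤ _ := le_rfl

end Residence

/-! ## Finite-dimensional distributions of continuous-time Markov chains -/

namespace CTMC

variable {S C : Type*}

/-- At time `t`, the path has made exactly `k` jumps and its state is `a`. -/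
def AfterJumps : ℕ → (ℕ → S × ℝ≥0∞) → ℝ≥0∞ → S → Prop
  | 0, π, t, a => t < (π 0).2 ∧ (π 0).1 = a
  | k + 1, π, t, a => (π 0).2 ≤ t ∧ AfterJumps k (fun n => π (n + 1)) (t - (π 0).2) a

/-- At time `t`, the path has made finitely many jumps and its state is `a`. -/
def IsAt (π : ℕ → S × ℝ≥0∞) (t : ℝ≥0∞) (a : S) : Prop := ∃ k, AfterJumps k π t a

lemma AfterJumps.unique {k l : ℕ} {π : ℕ → S × ℝ≥0∞} {t : ℝ≥0∞} {a b : S}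
    (h : AfterJumps k π t a) (h' : AfterJumps l π t b) : k = l ∧ a = b := by
  induction k generalizing l π t with
  | zero =>
    cases l with
    | zero => exact ⟨rfl, h.2.symm.trans h'.2⟩
    | succ l => exact absurd h.1 (not_lt.2 h'.1)
  | succ k ih =>
    cases l with
    | zero => exact absurd h'.1 (not_lt.2 h.1)
    | succ l =>
      obtain ⟨h1, h2⟩ := ih h.2 h'.2
      exact ⟨by rw [h1], h2⟩

lemma IsAt.unique {π : ℕ → S × ℝ≥0∞} {t : ℝ≥0∞} {a b : S} (h : IsAt π t a) (h' : IsAt π t b) :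
    a = b := by
  obtain ⟨k, hk⟩ := h
  obtain ⟨l, hl⟩ := h'
  exact (hk.unique hl).2

lemma isAt_consPath_of_le {x : S × ℝ≥0∞} {π : ℕ → S × ℝ≥0∞} {t : ℝ≥0∞} (h : x.2 ≤ t) (a : S) :
    IsAt (consPath x π) t a ↔ IsAt π (t - x.2) a := by
  constructor
  · rintro ⟨k, hk⟩
    cases k with
    | zero => exact absurd hk.1 (not_lt.2 h)
    | succ k => exact ⟨k, hk.2⟩
  · rintro ⟨k, hk⟩
    exact ⟨k + 1, h, hk⟩

/-- Pathwise counterpart of memorylessness: lengthening the first residence time and the observation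
time by the same `t` changes nothing. -/
lemma isAt_consPath_add {s : S} {τ t d : ℝ≥0∞} {π : ℕ → S × ℝ≥0∞} (ht : t ≠ ∞) (a : S) :
    IsAt (consPath (s, τ + t) π) (t + d) a ↔ IsAt (consPath (s, τ) π) d a := by
  rcases le_or_gt τ d with h | h
  · have h' : τ + t ≤ t + d := by rw [add_comm t d]; gcongr
    have e : t + d - (τ + t) = d - τ := by
      rw [add_comm t d, ENNReal.add_sub_add_eq_sub_right ht]
    rw [isAt_consPath_of_le (x := (s, τ)) h, isAt_consPath_of_le (x := (s, τ + t)) h']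
    simp only [e]
  · have h' : t + d < τ + t := by
      rw [add_comm τ t]
      exact ENNReal.add_lt_add_left ht h
    constructor
    · rintro ⟨k, hk⟩
      cases k with
      | zero => exact ⟨0, h, hk.2⟩
      | succ k => exact absurd hk.1 (not_le.2 h')
    · rintro ⟨k, hk⟩
      cases k with
      | zero => exact ⟨0, h', hk.2⟩
      | succ k => exact absurd hk.1 (not_le.2 h)

lemma AfterJumps.stateAt_aux {k : ℕ} {π : ℕ → S × ℝ≥0∞} {t : ℝ≥0∞} {a : S}
    (h : AfterJumps k π t a) (ht : t ≠ ∞) :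
    (t < ∑ j ∈ Finset.range (k + 1), (π j).2) ∧
      (∀ n < k, ¬ t < ∑ j ∈ Finset.range (n + 1), (π j).2) ∧ (π k).1 = a := by
  induction k generalizing π t with
  | zero => exact ⟨by simpa using h.1, by simp, h.2⟩
  | succ k ih =>
    obtain ⟨h1, h2, h3⟩ := ih h.2 (ENNReal.sub_ne_top ht)
    have hfin : (π 0).2 ≠ ∞ := ne_top_of_le_ne_top ht h.1
    have key : ∀ c, t < (π 0).2 + c ↔ t - (π 0).2 < c := fun c =>
      (ENNReal.sub_lt_iff_lt_left hfin h.1).symm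
    refine ⟨?_, fun n hn => ?_, h3⟩
    · rw [Finset.sum_range_succ', add_comm, key]
      exact h1
    · cases n with
      | zero => simpa using h.1
      | succ n =>
        rw [Finset.sum_range_succ', add_comm, key]
        exact h2 n (by lia)

/-- Connects `stateAt` with the recursive `IsAt`, which is adapted to first-step decompositions;
under `IsAt` the default branch of `stateAt` does not occur. -/
lemma IsAt.stateAt_eq {π : ℕ → S × ℝ≥0∞} {t : ℝ} {a : S} (h : IsAt π (ENNReal.ofReal t) a) :
    stateAt π t = a := by
  classical
  obtain ⟨k, hk⟩ := h
  obtain ⟨h1, h2, h3⟩ := hk.stateAt_aux ENNReal.ofReal_ne_top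
  have hex : ∃ n, ENNReal.ofReal t < ∑ k ∈ Finset.range (n + 1), (π k).2 := ⟨k, h1⟩
  rw [stateAt, dif_pos hex, (Nat.find_eq_iff hex).2 ⟨h1, h2⟩, h3]

variable [MeasurableSpace S]

/-- A family of events about the paths after time `t`, not depending on the past. -/
structure IsFuture (Φ : ℝ≥0∞ → Set (ℕ → S × ℝ≥0∞)) : Prop where
  measurableSet : ∀ t, MeasurableSet (Φ t)
  jump : ∀ x π t, t ≠ ∞ → x.2 ≤ t → (consPath x π ∈ Φ t ↔ π ∈ Φ (t - x.2))
  stay : ∀ s τ t d π, t ≠ ∞ → (consPath (s, τ + t) π ∈ Φ (t + d) ↔ consPath (s, τ) π ∈ Φ d)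

lemma isFuture_univ : IsFuture fun _ : ℝ≥0∞ => (Set.univ : Set (ℕ → S × ℝ≥0∞)) :=
  ⟨fun _ => MeasurableSet.univ, fun _ _ _ _ _ => Iff.rfl, fun _ _ _ _ _ _ => Iff.rfl⟩

variable [DiscreteMeasurableSpace S]

lemma measurableSet_afterJumps_uncurry (k : ℕ) (a : S) :
    MeasurableSet {p : (ℕ → S × ℝ≥0∞) × ℝ≥0∞ | AfterJumps k p.1 p.2 a} := by
  have h0 : Measurable fun p : (ℕ → S × ℝ≥0∞) × ℝ≥0∞ => (p.1 0).2 := by fun_prop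
  induction k with
  | zero =>
    have h1 : Measurable fun p : (ℕ → S × ℝ≥0∞) × ℝ≥0∞ => (p.1 0).1 := by fun_prop
    exact (measurableSet_lt measurable_snd h0).inter (h1 (MeasurableSet.of_discrete (s := {a})))
  | succ k ih =>
    have h1 : Measurable fun p : (ℕ → S × ℝ≥0∞) × ℝ≥0∞ =>
        ((fun n => p.1 (n + 1), p.2 - (p.1 0).2) : (ℕ → S × ℝ≥0∞) × ℝ≥0∞) := by fun_prop
    exact (measurableSet_le h0 measurable_snd).inter (h1 ih)

lemma measurableSet_afterJumps (k : ℕ) (t : ℝ≥0∞) (a : S) :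
    MeasurableSet {π : ℕ → S × ℝ≥0∞ | AfterJumps k π t a} :=
  (measurable_id.prodMk measurable_const) (measurableSet_afterJumps_uncurry k a)

lemma measurableSet_isAt (t : ℝ≥0∞) (a : S) :
    MeasurableSet {π : ℕ → S × ℝ≥0∞ | IsAt π t a} := by
  have : {π : ℕ → S × ℝ≥0∞ | IsAt π t a} = ⋃ k, {π | AfterJumps k π t a} := by
    ext; simp [IsAt]
  rw [this]
  exact MeasurableSet.iUnion fun k => measurableSet_afterJumps k t a

variable [Fintype S] (M : CTMC S C)

/-- The law of the timed paths that start in `s`. -/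
noncomputable def pathsFrom (s : S) : Measure (ℕ → S × ℝ≥0∞) :=
  chainMeasure M.stepKernel (M.entryLaw s)

instance (s : S) : IsProbabilityMeasure (M.pathsFrom s) := by unfold pathsFrom; infer_instance

/-- First-step decomposition: residence time, jump, and remaining path. -/
lemma pathsFrom_apply (s : S) {A : Set (ℕ → S × ℝ≥0∞)} (hA : MeasurableSet A) :
    M.pathsFrom s A = ∫⁻ τ, ∑ s', M.jump s s' * M.pathsFrom s' (consPath (s, τ) ⁻¹' A)
      ∂residenceLaw (M.rate s) := by
  have hm : Measurable (A.indicator (1 : (ℕ → S × ℝ≥0∞) → ℝ≥0∞)) := measurable_one.indicator hA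
  rw [← lintegral_indicator_one hA, pathsFrom, lintegral_chainMeasure _ _ hm, entryLaw,
    lintegral_prod _ (measurable_lintegral_chainMeasure_dirac _ hm).aemeasurable,
    lintegral_dirac' _ (Measurable.of_discrete)]
  refine lintegral_congr fun τ => ?_
  have hc : MeasurableSet (consPath (s, τ) ⁻¹' A) := measurable_consPath _ hA
  have hm' : Measurable fun ω => (A.indicator (1 : (ℕ → S × ℝ≥0∞) → ℝ≥0∞)) (consPath (s, τ) ω) :=
    hm.comp (measurable_consPath _)
  have hκ : M.stepKernel (s, τ) = (M.jump s).toMeasure.bind M.entryLaw := rfl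
  rw [lintegral_chainMeasure_dirac _ _ hm, lintegral_chainMeasure _ _ hm', hκ,
    Measure.lintegral_bind (Measurable.of_discrete).aemeasurable
      (measurable_lintegral_chainMeasure_dirac _ hm').aemeasurable, lintegral_fintype]
  refine Finset.sum_congr rfl fun s' _ => ?_
  rw [← lintegral_chainMeasure _ _ hm', PMF.toMeasure_apply_singleton _ _ (.of_discrete), mul_comm]
  congr 1
  change ∫⁻ ω, (consPath (s, τ) ⁻¹' A).indicator 1 ω ∂M.pathsFrom s' = _
  rw [lintegral_indicator_one hc]

/-- The probability of being in `a` at time `t` after exactly `k` jumps. -/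
noncomputable def jumpProb (k : ℕ) (s : S) (t : ℝ≥0∞) (a : S) : ℝ≥0∞ :=
  M.pathsFrom s {π | AfterJumps k π t a}

lemma measurable_jumpProb (k : ℕ) (s a : S) : Measurable fun t => M.jumpProb k s t a :=
  measurable_measure_prodMk_right (measurableSet_afterJumps_uncurry k a)

/-- Condition on the first residence time `τ`: a jump before `t` requires `τ ≤ t` and restarts the
clock with `t - τ` left. -/
lemma pathsFrom_afterJumps_succ_inter {Φ : ℝ≥0∞ → Set (ℕ → S × ℝ≥0∞)} (hΦ : IsFuture Φ)
    (k : ℕ) (s a : S) {t : ℝ≥0∞} (ht : t ≠ ∞) :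
    M.pathsFrom s ({π | AfterJumps (k + 1) π t a} ∩ Φ t) =
      ∫⁻ τ in Set.Iic t, ∑ s', M.jump s s' *
        M.pathsFrom s' ({π | AfterJumps k π (t - τ) a} ∩ Φ (t - τ)) ∂residenceLaw (M.rate s) := by
  rw [M.pathsFrom_apply s ((measurableSet_afterJumps _ t a).inter (hΦ.measurableSet t)),
    ← lintegral_indicator measurableSet_Iic]
  refine lintegral_congr fun τ => ?_
  by_cases hτ : τ ≤ t
  · rw [Set.indicator_of_mem (Set.mem_Iic.2 hτ)]
    refine Finset.sum_congr rfl fun s' _ => ?_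
    congr 2
    ext π
    simp only [Set.preimage_inter, Set.mem_inter_iff, Set.mem_preimage, Set.mem_ofPred_eq,
      hΦ.jump (s, τ) π t ht hτ]
    exact and_congr_left fun _ => ⟨fun h => h.2, fun h => ⟨hτ, h⟩⟩
  · rw [Set.indicator_of_notMem (fun h => hτ (Set.mem_Iic.1 h))]
    refine Finset.sum_eq_zero fun s' _ => ?_
    have : consPath (s, τ) ⁻¹' ({π | AfterJumps (k + 1) π t a} ∩ Φ t) = ∅ := by
      ext π
      simp only [Set.mem_preimage, Set.mem_inter_iff, Set.mem_ofPred_eq, Set.mem_empty_iff_false,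
        iff_false]
      exact fun h => hτ h.1.1
    rw [this, measure_empty, mul_zero]

lemma pathsFrom_afterJumps_zero_inter [DecidableEq S] {Φ : ℝ≥0∞ → Set (ℕ → S × ℝ≥0∞)}
    (hΦ : IsFuture Φ) (s a : S) {t : ℝ≥0∞} (ht : t ≠ ∞) :
    M.pathsFrom s ({π | AfterJumps 0 π t a} ∩ Φ t) =
      (if s = a then ENNReal.ofReal (Real.exp (-(M.rate s * t.toReal))) else 0) *
        M.pathsFrom a (Φ 0) := by
  rw [M.pathsFrom_apply s ((measurableSet_afterJumps _ t a).inter (hΦ.measurableSet t))]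
  split_ifs with hsa
  · subst hsa
    set g : ℝ≥0∞ → ℝ≥0∞ := fun τ => ∑ s', M.jump s s' *
      M.pathsFrom s' (consPath (s, τ) ⁻¹' Φ t) with hg
    have hgm : Measurable g := by
      refine Finset.measurable_sum _ fun s' _ => Measurable.const_mul ?_ _
      have hpre : MeasurableSet {p : ℝ≥0∞ × (ℕ → S × ℝ≥0∞) | consPath (s, p.1) p.2 ∈ Φ t} :=
        (measurable_consPath_uncurry.comp (by fun_prop :
          Measurable fun p : ℝ≥0∞ × (ℕ → S × ℝ≥0∞) => ((s, p.1), p.2))) (hΦ.measurableSet t)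
      exact measurable_measure_prodMk_left hpre
    have e : ∀ τ, ∑ s', M.jump s s' * M.pathsFrom s'
        (consPath (s, τ) ⁻¹' ({π | AfterJumps 0 π t s} ∩ Φ t)) = (Set.Ioi t).indicator g τ := by
      intro τ
      by_cases hτ : t < τ
      · rw [Set.indicator_of_mem (Set.mem_Ioi.2 hτ)]
        refine Finset.sum_congr rfl fun s' _ => ?_
        congr 2
        ext π
        simp only [Set.mem_preimage, Set.mem_inter_iff, Set.mem_ofPred_eq]
        exact ⟨fun h => h.2, fun h => ⟨⟨hτ, rfl⟩, h⟩⟩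
      · rw [Set.indicator_of_notMem (fun h => hτ (Set.mem_Ioi.1 h))]
        refine Finset.sum_eq_zero fun s' _ => ?_
        have : consPath (s, τ) ⁻¹' ({π | AfterJumps 0 π t s} ∩ Φ t) = ∅ := by
          ext π
          simp only [Set.mem_preimage, Set.mem_inter_iff, Set.mem_ofPred_eq,
            Set.mem_empty_iff_false, iff_false]
          exact fun h => hτ h.1.1
        rw [this, measure_empty, mul_zero]
    simp_rw [e]
    -- Given survival beyond `t`, the residual residence time has the original law, so the integral
    -- is again the law of a path that starts in `s`.
    rw [lintegral_indicator measurableSet_Ioi, setLIntegral_residenceLaw_Ioi _ ht hgm,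
      M.pathsFrom_apply s (hΦ.measurableSet 0)]
    congr 1
    refine lintegral_congr fun τ => Finset.sum_congr rfl fun s' _ => ?_
    congr 2
    ext π
    have := hΦ.stay s τ t 0 π ht
    rw [add_zero] at this
    exact this
  · rw [zero_mul, lintegral_eq_zero_of_ae_eq_zero]
    refine Filter.Eventually.of_forall fun τ => Finset.sum_eq_zero fun s' _ => ?_
    have : consPath (s, τ) ⁻¹' ({π | AfterJumps 0 π t a} ∩ Φ t) = ∅ := by
      ext π
      simp only [Set.mem_preimage, Set.mem_inter_iff, Set.mem_ofPred_eq, Set.mem_empty_iff_false,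
        iff_false]
      exact fun h => hsa h.1.2
    rw [this, measure_empty, mul_zero]

lemma jumpProb_zero [DecidableEq S] (s a : S) {t : ℝ≥0∞} (ht : t ≠ ∞) :
    M.jumpProb 0 s t a =
      if s = a then ENNReal.ofReal (Real.exp (-(M.rate s * t.toReal))) else 0 := by
  have h := M.pathsFrom_afterJumps_zero_inter isFuture_univ s a ht
  rwa [Set.inter_univ, measure_univ, mul_one] at h

lemma jumpProb_succ (k : ℕ) (s a : S) {t : ℝ≥0∞} (ht : t ≠ ∞) :
    M.jumpProb (k + 1) s t a = ∫⁻ τ in Set.Iic t, ∑ s', M.jump s s' * M.jumpProb k s' (t - τ) a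
      ∂residenceLaw (M.rate s) := by
  have h := M.pathsFrom_afterJumps_succ_inter isFuture_univ k s a ht
  simp only [Set.inter_univ] at h
  exact h

/-- Markov property for the event of being in `a` after exactly `k` jumps. -/
lemma pathsFrom_afterJumps_inter {Φ : ℝ≥0∞ → Set (ℕ → S × ℝ≥0∞)} (hΦ : IsFuture Φ)
    (k : ℕ) (s a : S) {t : ℝ≥0∞} (ht : t ≠ ∞) :
    M.pathsFrom s ({π | AfterJumps k π t a} ∩ Φ t) = M.jumpProb k s t a * M.pathsFrom a (Φ 0) := by
  classical
  induction k generalizing s t with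
  | zero => rw [M.pathsFrom_afterJumps_zero_inter hΦ s a ht, M.jumpProb_zero s a ht]
  | succ k ih =>
    rw [M.pathsFrom_afterJumps_succ_inter hΦ _ _ _ ht, M.jumpProb_succ _ _ _ ht,
      ← lintegral_mul_const' _ _ (measure_ne_top _ _)]
    refine lintegral_congr fun τ => ?_
    rw [Finset.sum_mul]
    refine Finset.sum_congr rfl fun s' _ => ?_
    rw [ih s' (ENNReal.sub_ne_top ht), mul_assoc]

end CTMC

/-! ### Expansion of the transient probabilities over the number of jumps, and the Markov property.
-/

namespace CTMC

variable {S C : Type*} [Fintype S] (M : CTMC S C)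

/-- The part of the transient probability that is due to paths with at least `k` jumps. -/
noncomputable def jumpRemainder (a : S) : ℕ → S → ℝ≥0∞ → ℝ≥0∞
  | 0, s, t => ENNReal.ofReal (M.transient t.toReal s a)
  | k + 1, s, t => ∫⁻ τ in Set.Iic t, ∑ s', M.jump s s' * jumpRemainder a k s' (t - τ)
      ∂residenceLaw (M.rate s)

/-- The backward equation as an integral against the residence law. This form covers exit rate `0`,
where the law has no density, and can be iterated. -/
lemma transient_eq_add_lintegral [DecidableEq S] (s a : S) {t : ℝ≥0∞} (ht : t ≠ ∞) :
    ENNReal.ofReal (M.transient t.toReal s a) =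
      (if s = a then ENNReal.ofReal (Real.exp (-(M.rate s * t.toReal))) else 0) +
        M.jumpRemainder a 1 s t := by
  have hT : 0 ≤ t.toReal := ENNReal.toReal_nonneg
  set r := M.rate s with hr
  have hnn : ∀ u ∈ Set.Ioc 0 t.toReal, 0 ≤ r * Real.exp (-(r * u)) *
      ∑ b, (M.jump s b).toReal * M.transient (t.toReal - u) b a := by
    intro u hu
    refine mul_nonneg (by positivity) (Finset.sum_nonneg fun b _ => ?_)
    exact mul_nonneg ENNReal.toReal_nonneg (M.transient_nonneg (sub_nonneg.2 hu.2) b a)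
  have hcont : Continuous fun u : ℝ => (r : ℝ) * Real.exp (-(r * u)) *
      ∑ b, (M.jump s b).toReal * M.transient (t.toReal - u) b a := by
    refine Continuous.mul (by fun_prop) (continuous_finsetSum _ fun b _ => ?_)
    exact continuous_const.mul ((M.continuous_transient b a).comp (by fun_prop))
  have hI : ENNReal.ofReal (∫ u in (0 : ℝ)..t.toReal, r * Real.exp (-(r * u)) *
      ∑ b, (M.jump s b).toReal * M.transient (t.toReal - u) b a) = M.jumpRemainder a 1 s t := by
    rw [intervalIntegral.integral_of_le hT, ofReal_integral_eq_lintegral_ofReal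
      (hcont.integrableOn_Ioc) ((ae_restrict_iff' measurableSet_Ioc).2
        (Filter.Eventually.of_forall hnn))]
    simp only [jumpRemainder, ← hr]
    by_cases hr0 : r = 0
    · simp only [hr0]
      rw [residenceLaw, if_pos rfl]
      simp only [NNReal.coe_zero, zero_mul, ENNReal.ofReal_zero, lintegral_zero]
      rw [← lintegral_indicator measurableSet_Iic, lintegral_dirac,
        Set.indicator_of_notMem (by simpa using ht)]
    · have hm : Measurable fun τ : ℝ≥0∞ => ∑ s', M.jump s s' *
          ENNReal.ofReal (M.transient (t - τ).toReal s' a) := by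
        refine Finset.measurable_sum _ fun b _ => Measurable.const_mul ?_ _
        exact ((M.continuous_transient b a).measurable.comp (by fun_prop)).ennreal_ofReal
      rw [← lintegral_indicator measurableSet_Iic,
        lintegral_residenceLaw hr0 (hm.indicator measurableSet_Iic),
        ← lintegral_indicator measurableSet_Ioc, ← lintegral_indicator measurableSet_Ioi]
      refine lintegral_congr fun x => ?_
      by_cases hx : 0 < x
      · rw [Set.indicator_of_mem (s := Set.Ioi (0 : ℝ)) hx]
        by_cases hxt : x ≤ t.toReal
        · have hmem : ENNReal.ofReal x ∈ Set.Iic t := ENNReal.ofReal_le_of_le_toReal hxt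
          rw [Set.indicator_of_mem (s := Set.Ioc (0 : ℝ) t.toReal) ⟨hx, hxt⟩,
            Set.indicator_of_mem hmem, ENNReal.ofReal_mul (by positivity),
            ENNReal.toReal_sub_of_le hmem ht, ENNReal.toReal_ofReal hx.le,
            ENNReal.ofReal_sum_of_nonneg]
          · congr 1
            refine Finset.sum_congr rfl fun b _ => ?_
            rw [ENNReal.ofReal_mul ENNReal.toReal_nonneg,
              ENNReal.ofReal_toReal (PMF.apply_ne_top _ _)]
          · exact fun b _ => mul_nonneg ENNReal.toReal_nonneg
              (M.transient_nonneg (sub_nonneg.2 hxt) b a)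
        · rw [Set.indicator_of_notMem (fun h => hxt h.2), Set.indicator_of_notMem, mul_zero]
          rw [Set.mem_Iic, not_le]
          exact (ENNReal.lt_ofReal_iff_toReal_lt ht).2 (not_le.1 hxt)
      · rw [Set.indicator_of_notMem (fun h => hx h.1),
          Set.indicator_of_notMem (s := Set.Ioi (0 : ℝ)) hx]
  rw [M.transient_eq_add_integral, ENNReal.ofReal_add _ _, hI]
  · congr 1
    split_ifs
    · rfl
    · exact ENNReal.ofReal_zero
  · split_ifs <;> positivity
  · rw [intervalIntegral.integral_of_le hT]
    exact setIntegral_nonneg measurableSet_Ioc hnn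

/-- Each jump contracts the bound in the supremum norm weighted by `exp (-t)`: the factor is the
Laplace transform of the residence time at `1`, at most `c`. -/
lemma jumpRemainder_le (a : S) {c : ℝ} (hc0 : 0 ≤ c)
    (hc : ∀ s, (M.rate s : ℝ) / (M.rate s + 1) ≤ c) (k : ℕ) (s : S) {t : ℝ≥0∞} (ht : t ≠ ∞) :
    M.jumpRemainder a k s t ≤ ENNReal.ofReal (c ^ k * Real.exp t.toReal) := by
  induction k generalizing s t with
  | zero =>
    refine ENNReal.ofReal_le_ofReal ?_
    rw [pow_zero, one_mul]
    exact (M.transient_le_one ENNReal.toReal_nonneg s a).trans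
      (Real.one_le_exp ENNReal.toReal_nonneg)
  | succ k ih =>
    have h1 : M.jumpRemainder a (k + 1) s t ≤ ∫⁻ τ in Set.Iic t,
        ENNReal.ofReal (c ^ k * Real.exp t.toReal) * ENNReal.ofReal (Real.exp (-τ.toReal))
        ∂residenceLaw (M.rate s) := by
      rw [jumpRemainder]
      refine setLIntegral_mono' measurableSet_Iic fun τ hτ => ?_
      calc ∑ s', M.jump s s' * M.jumpRemainder a k s' (t - τ)
          ≤ ∑ s', M.jump s s' * ENNReal.ofReal (c ^ k * Real.exp (t - τ).toReal) :=
            Finset.sum_le_sum fun b _ => mul_le_mul_right (ih b (ENNReal.sub_ne_top ht)) _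
        _ = ENNReal.ofReal (c ^ k * Real.exp (t - τ).toReal) := by
            rw [← Finset.sum_mul, PMF.sum_coe_fintype, one_mul]
        _ = _ := by
            rw [ENNReal.toReal_sub_of_le hτ ht, sub_eq_add_neg, Real.exp_add, ← mul_assoc,
              ENNReal.ofReal_mul (by positivity)]
    refine h1.trans ?_
    rw [lintegral_const_mul _ (by fun_prop)]
    refine (mul_le_mul_right (setLIntegral_residenceLaw_exp_le _ ht) _).trans ?_
    rw [← ENNReal.ofReal_mul (by positivity)]
    refine ENNReal.ofReal_le_ofReal ?_
    rw [pow_succ]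
    nlinarith [mul_le_mul_of_nonneg_left (hc s)
      (mul_nonneg (pow_nonneg hc0 k) (Real.exp_pos t.toReal).le)]

lemma tendsto_jumpRemainder (a s : S) {t : ℝ≥0∞} (ht : t ≠ ∞) :
    Filter.Tendsto (fun k => M.jumpRemainder a k s t) Filter.atTop (nhds 0) := by
  -- `R` dominates every exit rate and `x / (x + 1)` is increasing, so `c < 1` is a uniform
  -- contraction factor.
  set R : ℝ := ∑ b, (M.rate b : ℝ) with hR
  have hR0 : 0 ≤ R := Finset.sum_nonneg fun b _ => NNReal.coe_nonneg _
  set c := R / (R + 1) with hc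
  have hc0 : 0 ≤ c := by positivity
  have hc1 : c < 1 := (div_lt_one (by positivity)).2 (by linarith)
  have hle : ∀ b, (M.rate b : ℝ) / (M.rate b + 1) ≤ c := by
    intro b
    have h1 : (M.rate b : ℝ) ≤ R :=
      Finset.single_le_sum (f := fun b => (M.rate b : ℝ)) (fun b _ => NNReal.coe_nonneg _)
        (Finset.mem_univ b)
    rw [hc, div_le_div_iff₀ (by positivity) (by positivity)]
    nlinarith
  have hlim : Filter.Tendsto (fun k : ℕ => ENNReal.ofReal (c ^ k * Real.exp t.toReal))
      Filter.atTop (nhds 0) := by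
    have := ((tendsto_pow_atTop_nhds_zero_of_lt_one hc0 hc1).mul_const (Real.exp t.toReal))
    rw [zero_mul] at this
    simpa using ENNReal.tendsto_ofReal this
  exact tendsto_of_tendsto_of_tendsto_of_le_of_le tendsto_const_nhds hlim (fun _ => zero_le)
    fun k => M.jumpRemainder_le a hc0 hle k s ht

variable [MeasurableSpace S] [DiscreteMeasurableSpace S]

/-- All terms obey the same first-jump recursion, so the backward equation, which is the case `k =
0`, propagates to every `k`. -/
lemma jumpRemainder_eq_add (a : S) (k : ℕ) (s : S) {t : ℝ≥0∞} (ht : t ≠ ∞) :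
    M.jumpRemainder a k s t = M.jumpProb k s t a + M.jumpRemainder a (k + 1) s t := by
  classical
  induction k generalizing s t with
  | zero =>
    rw [M.jumpProb_zero s a ht]
    exact M.transient_eq_add_lintegral s a ht
  | succ k ih =>
    rw [M.jumpProb_succ _ _ _ ht, jumpRemainder]
    conv_rhs => rw [jumpRemainder]
    rw [← lintegral_add_left]
    · refine lintegral_congr fun τ => ?_
      rw [← Finset.sum_add_distrib]
      refine Finset.sum_congr rfl fun b _ => ?_
      rw [← mul_add, ← ih b (ENNReal.sub_ne_top ht)]
    · refine Finset.measurable_sum _ fun b _ => Measurable.const_mul ?_ _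
      exact (M.measurable_jumpProb k b a).comp (by fun_prop)

lemma transient_eq_sum_add_jumpRemainder (a : S) (N : ℕ) (s : S) {t : ℝ≥0∞} (ht : t ≠ ∞) :
    ENNReal.ofReal (M.transient t.toReal s a) =
      ∑ k ∈ Finset.range N, M.jumpProb k s t a + M.jumpRemainder a N s t := by
  induction N with
  | zero => simp [jumpRemainder]
  | succ N ih => rw [ih, Finset.sum_range_succ, add_assoc, ← M.jumpRemainder_eq_add a N s ht]

lemma tsum_jumpProb (s a : S) {t : ℝ≥0∞} (ht : t ≠ ∞) :
    ∑' k, M.jumpProb k s t a = ENNReal.ofReal (M.transient t.toReal s a) := by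
  have h1 := ENNReal.tendsto_nat_tsum fun k => M.jumpProb k s t a
  have h2 := h1.add (M.tendsto_jumpRemainder a s ht)
  rw [add_zero] at h2
  refine tendsto_nhds_unique h2 (tendsto_const_nhds.congr fun N => ?_)
  exact M.transient_eq_sum_add_jumpRemainder a N s ht

/-- Markov property at a fixed time. -/
lemma pathsFrom_isAt_inter {Φ : ℝ≥0∞ → Set (ℕ → S × ℝ≥0∞)} (hΦ : IsFuture Φ) (s a : S)
    {t : ℝ≥0∞} (ht : t ≠ ∞) :
    M.pathsFrom s ({π | IsAt π t a} ∩ Φ t) =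
      ENNReal.ofReal (M.transient t.toReal s a) * M.pathsFrom a (Φ 0) := by
  have hU : {π : ℕ → S × ℝ≥0∞ | IsAt π t a} ∩ Φ t = ⋃ k, ({π | AfterJumps k π t a} ∩ Φ t) := by
    ext π
    simp [IsAt]
  rw [hU, measure_iUnion]
  · simp_rw [M.pathsFrom_afterJumps_inter hΦ _ s a ht]
    rw [ENNReal.tsum_mul_right, M.tsum_jumpProb s a ht]
  · intro k l hkl
    rw [Function.onFun, Set.disjoint_left]
    exact fun π h h' => hkl (AfterJumps.unique h.1 h'.1).1
  · exact fun k => (measurableSet_afterJumps k t a).inter (hΦ.measurableSet t)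

lemma pathsFrom_isAt (s a : S) {t : ℝ≥0∞} (ht : t ≠ ∞) :
    M.pathsFrom s {π | IsAt π t a} = ENNReal.ofReal (M.transient t.toReal s a) := by
  have h := M.pathsFrom_isAt_inter isFuture_univ s a ht
  rwa [Set.inter_univ, measure_univ, mul_one] at h

/-- Almost surely, only finitely many jumps occur up to a fixed time. -/
lemma ae_exists_isAt (s : S) {t : ℝ≥0∞} (ht : t ≠ ∞) : ∀ᵐ π ∂M.pathsFrom s, ∃ a, IsAt π t a := by
  have hm : MeasurableSet {π : ℕ → S × ℝ≥0∞ | ∃ a, IsAt π t a} := by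
    have : {π : ℕ → S × ℝ≥0∞ | ∃ a, IsAt π t a} = ⋃ a, {π | IsAt π t a} := by ext; simp
    rw [this]
    exact MeasurableSet.iUnion fun a => measurableSet_isAt t a
  refine (mem_ae_iff_prob_eq_one hm).2 ?_
  have hU : {π : ℕ → S × ℝ≥0∞ | ∃ a, IsAt π t a} = ⋃ a ∈ Finset.univ, {π | IsAt π t a} := by
    ext; simp
  rw [hU, measure_biUnion_finset]
  · simp_rw [M.pathsFrom_isAt s _ ht]
    rw [← ENNReal.ofReal_sum_of_nonneg fun a _ => M.transient_nonneg ENNReal.toReal_nonneg s a,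
      M.sum_transient, ENNReal.ofReal_one]
  · intro a _ b _ hab
    rw [Function.onFun, Set.disjoint_left]
    exact fun π h h' => hab (IsAt.unique h h')
  · exact fun a _ => measurableSet_isAt t a

/-- The event that from time `t` on, after waiting times `δ k, …, δ (k + m - 1)`, the state lies in
`B (k + 1), …, B (k + m)`, respectively. -/
def waitEvent {S : Type*} (δ : ℕ → ℝ≥0∞) (B : ℕ → Set S) :
    ℕ → ℕ → ℝ≥0∞ → Set (ℕ → S × ℝ≥0∞)
  | 0, _, _ => Set.univ
  | m + 1, k, t => {π | ∃ a ∈ B (k + 1), IsAt π (t + δ k) a} ∩ waitEvent δ B m (k + 1) (t + δ k)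

open Classical in
/-- The probability of the corresponding event for paths that start in `s`. -/
noncomputable def waitProb (δ : ℕ → ℝ) (B : ℕ → Set S) : ℕ → ℕ → S → ℝ
  | 0, _, _ => 1
  | m + 1, k, s => ∑ a, M.transient (δ k) s a *
      if a ∈ B (k + 1) then waitProb δ B m (k + 1) a else 0

/-- The offset `d` is arbitrary because the induction adds the waiting time `δ k` to it. -/
lemma isFuture_waitEvent (δ : ℕ → ℝ≥0∞) (B : ℕ → Set S) (m k : ℕ) (d : ℝ≥0∞) :
    IsFuture fun t => waitEvent δ B m k (t + d) := by
  induction m generalizing k d with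
  | zero => exact isFuture_univ
  | succ m ih =>
    have ih' := ih (k + 1) (d + δ k)
    refine ⟨fun t => ?_, fun x π t ht hx => ?_, fun s τ t e π ht => ?_⟩
    · have hU : {π : ℕ → S × ℝ≥0∞ | ∃ a ∈ B (k + 1), IsAt π (t + d + δ k) a}
          = ⋃ a ∈ B (k + 1), {π | IsAt π (t + d + δ k) a} := by ext; simp
      have hm := ih'.measurableSet t
      rw [← add_assoc] at hm
      refine MeasurableSet.inter ?_ hm
      rw [hU]
      exact MeasurableSet.biUnion (Set.to_countable _) fun a _ => measurableSet_isAt _ a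
    · have h2 := ih'.jump x π t ht hx
      have e1 : t + d + δ k - x.2 = t - x.2 + d + δ k := by
        rw [add_assoc, add_assoc, ENNReal.sub_add_eq_add_sub hx (ne_top_of_le_ne_top ht hx)]
      have h1 : (∃ a ∈ B (k + 1), IsAt (consPath x π) (t + d + δ k) a) ↔
          ∃ a ∈ B (k + 1), IsAt π (t - x.2 + d + δ k) a := by
        refine exists_congr fun a => and_congr_right fun _ => ?_
        rw [isAt_consPath_of_le (hx.trans (by rw [add_assoc]; exact le_self_add)), e1]
      simp only [← add_assoc] at h2
      exact and_congr h1 h2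
    · have h2 := ih'.stay s τ t e π ht
      have h1 : (∃ a ∈ B (k + 1), IsAt (consPath (s, τ + t) π) (t + e + d + δ k) a) ↔
          ∃ a ∈ B (k + 1), IsAt (consPath (s, τ) π) (e + d + δ k) a := by
        refine exists_congr fun a => and_congr_right fun _ => ?_
        rw [add_assoc, add_assoc, isAt_consPath_add ht, ← add_assoc]
      simp only [← add_assoc] at h2
      exact and_congr h1 h2

/-- Apply the Markov property at the first observation time and sum over the state found there; the
rest is a future event. -/
lemma pathsFrom_waitEvent (δ : ℕ → ℝ) (B : ℕ → Set S) (hδ : ∀ k, 0 ≤ δ k) (m k : ℕ) (s : S) :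
    M.pathsFrom s (waitEvent (fun k => ENNReal.ofReal (δ k)) B m k 0)
      = ENNReal.ofReal (M.waitProb δ B m k s) := by
  classical
  induction m generalizing k s with
  | zero => simp [waitEvent, waitProb]
  | succ m ih =>
    set d := ENNReal.ofReal (δ k) with hd
    have hΦ := isFuture_waitEvent (fun k => ENNReal.ofReal (δ k)) B m (k + 1) 0
    simp only [add_zero] at hΦ
    have hU : waitEvent (fun k => ENNReal.ofReal (δ k)) B (m + 1) k 0
        = ⋃ a ∈ Finset.univ.filter (· ∈ B (k + 1)), ({π | IsAt π d a} ∩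
          waitEvent (fun k => ENNReal.ofReal (δ k)) B m (k + 1) d) := by
      ext π
      simp only [waitEvent, zero_add, ← hd, Finset.mem_filter, Finset.mem_univ, true_and,
        Set.mem_iUnion, Set.mem_inter_iff, Set.mem_ofPred_eq, exists_prop]
      exact ⟨fun ⟨⟨a, ha, h⟩, h'⟩ => ⟨a, ha, h, h'⟩, fun ⟨a, ha, h, h'⟩ => ⟨⟨a, ha, h⟩, h'⟩⟩
    have hpos : ∀ m k s, 0 ≤ M.waitProb δ B m k s := by
      intro m
      induction m with
      | zero => exact fun _ _ => zero_le_one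
      | succ m ihm =>
        intro k s
        refine Finset.sum_nonneg fun a _ => mul_nonneg (M.transient_nonneg (hδ k) s a) ?_
        split_ifs
        · exact ihm _ _
        · exact le_rfl
    rw [hU, measure_biUnion_finset]
    · simp_rw [M.pathsFrom_isAt_inter hΦ s _ (show d ≠ ∞ from ENNReal.ofReal_ne_top), ih]
      rw [waitProb, ENNReal.ofReal_sum_of_nonneg, Finset.sum_filter]
      · refine Finset.sum_congr rfl fun a _ => ?_
        rw [ENNReal.ofReal_mul (M.transient_nonneg (hδ k) s a), hd,
          ENNReal.toReal_ofReal (hδ k)]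
        split_ifs <;> simp
      · intro a _
        refine mul_nonneg (M.transient_nonneg (hδ k) s a) ?_
        split_ifs
        · exact hpos _ _ _
        · exact le_rfl
    · intro a _ b _ hab
      rw [Function.onFun, Set.disjoint_left]
      exact fun π h h' => hab (IsAt.unique h.1 h'.1)
    · exact fun a _ => (measurableSet_isAt d a).inter (hΦ.measurableSet d)

/-- The finite-dimensional distributions at increasing times `T 1, …, T N`. -/
lemma pathsFrom_stateAt (T : ℕ → ℝ) (B : ℕ → Set S) (N : ℕ) (hT0 : T 0 = 0)
    (hT : ∀ k < N, T k ≤ T (k + 1)) (s : S) :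
    M.pathsFrom s {π | ∀ i, 0 < i → i ≤ N → stateAt π (T i) ∈ B i}
      = ENNReal.ofReal (M.waitProb (fun k => |T (k + 1) - T k|) B N 0 s) := by
  -- `T` increases only up to `N`; the absolute values keep the waiting times nonnegative at every
  -- index.
  rw [← M.pathsFrom_waitEvent _ _ (fun k => abs_nonneg _)]
  refine measure_congr ?_
  have hpos : ∀ k ≤ N, 0 ≤ T k := by
    intro k
    induction k with
    | zero => exact fun _ => hT0.ge
    | succ k ih => exact fun hk => (ih (by lia)).trans (hT k (by lia))
  have hmem : ∀ π m k, k + m ≤ N → (π ∈ waitEvent (fun k => ENNReal.ofReal |T (k + 1) - T k|) B m k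
      (ENNReal.ofReal (T k)) ↔
        ∀ i, k < i → i ≤ k + m → ∃ a ∈ B i, IsAt π (ENNReal.ofReal (T i)) a) := by
    intro π m
    induction m with
    | zero =>
      intro k _
      exact ⟨fun _ i h1 h2 => absurd h1 (by lia), fun _ => trivial⟩
    | succ m ih =>
      intro k hk
      have e : ENNReal.ofReal (T k) + ENNReal.ofReal |T (k + 1) - T k|
          = ENNReal.ofReal (T (k + 1)) := by
        rw [abs_of_nonneg (sub_nonneg.2 (hT k (by lia))),
          ← ENNReal.ofReal_add (hpos k (by lia)) (sub_nonneg.2 (hT k (by lia)))]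
        congr 1
        ring
      simp only [waitEvent, Set.mem_inter_iff, Set.mem_ofPred_eq, e, ih (k + 1) (by lia)]
      constructor
      · rintro ⟨h1, h2⟩ i hi hi'
        rcases Nat.lt_or_ge (k + 1) i with h | h
        · exact h2 i h (by lia)
        · obtain rfl : i = k + 1 := by lia
          exact h1
      · exact fun h => ⟨h (k + 1) (by lia) (by lia), fun i hi hi' => h i (by lia) (by lia)⟩
  -- Off a null set the path has a well-defined state at each `T i`, so `stateAt` and `IsAt`
  -- describe the same event.
  have hae : ∀ᵐ π ∂M.pathsFrom s, ∀ i : ℕ, ∃ a, IsAt π (ENNReal.ofReal (T i)) a :=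
    ae_all_iff.2 fun i => M.ae_exists_isAt s ENNReal.ofReal_ne_top
  filter_upwards [hae] with π hπ
  have h0 := hmem π N 0 (by lia)
  rw [hT0, ENNReal.ofReal_zero] at h0
  refine propext (Iff.trans ?_ h0.symm)
  change (∀ i, 0 < i → i ≤ N → stateAt π (T i) ∈ B i) ↔ _
  refine forall_congr' fun i => imp_congr_right fun _ => ?_
  rw [Nat.zero_add]
  refine imp_congr_right fun _ => ?_
  obtain ⟨a, ha⟩ := hπ i
  rw [ha.stateAt_eq]
  exact ⟨fun h => ⟨a, h, ha⟩, fun ⟨b, hb, hb'⟩ => ha.unique hb' ▸ hb⟩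

end CTMC

/-! ## The evidence graph -/

namespace ImpreciseEvidence

variable {S C : Type*} {n : ℕ} {Ω : ImpreciseEvidence C n}

lemma times_nonempty (Ω : ImpreciseEvidence C n) (i : Fin (n + 1)) : (Ω.times i).Nonempty := by
  obtain ⟨q, lo, hi, hle, h⟩ := Ω.isUnion i
  rw [h]
  exact ⟨lo 0, Set.mem_iUnion.2 ⟨0, Set.left_mem_Icc.2 (hle 0)⟩⟩

lemma nonempty_instance (Ω : ImpreciseEvidence C n) : Nonempty Ω.Instance :=
  ⟨fun i => ⟨_, (Ω.times_nonempty i).some_mem⟩⟩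

/-- The position of a node on the paths of the evidence graph. -/
def Node.layer : Ω.Node → ℕ
  | .init => 0
  | .obs i _ => i + 1
  | .term => n + 2

lemma pathNode_of_lt (ρ : Ω.Instance) {k : ℕ} (hk : k < n + 1) :
    Ω.pathNode ρ (k + 1) = .obs ⟨k, hk⟩ (ρ ⟨k, hk⟩) := by
  rw [pathNode, dif_pos hk]

lemma pathNode_last (ρ : Ω.Instance) : Ω.pathNode ρ (n + 2) = .term := by
  rw [pathNode, dif_neg (by lia)]

lemma layer_pathNode (ρ : Ω.Instance) {k : ℕ} (hk : k ≤ n + 2) :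
    (Ω.pathNode ρ k).layer = k := by
  cases k with
  | zero => rfl
  | succ k =>
    rcases Nat.lt_or_ge k (n + 1) with h | h
    · rw [pathNode_of_lt ρ h]; rfl
    · obtain rfl : k = n + 1 := by lia
      rw [pathNode_last]; rfl

lemma pathNode_ne_term (ρ : Ω.Instance) {k : ℕ} (hk : k ≤ n + 1) :
    Ω.pathNode ρ k ≠ .term := by
  intro h
  have := layer_pathNode ρ (k := k) (by lia)
  rw [h] at this
  simp only [Node.layer] at this
  lia

lemma edge_pathNode (ρ : Ω.Instance) {k : ℕ} (hk : k ≤ n + 1) :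
    Ω.pathNode ρ (k + 1) ∈ Ω.enabledActions (Ω.pathNode ρ k) := Or.inl ⟨ρ, k, hk, rfl, rfl⟩

lemma exists_pathNode_eq (x : Ω.Node) (hx : x ≠ .term) :
    ∃ ρ : Ω.Instance, ∃ k ≤ n + 1, x = Ω.pathNode ρ k := by
  classical
  obtain ⟨ρ₀⟩ := Ω.nonempty_instance
  cases x with
  | init => exact ⟨ρ₀, 0, by lia, rfl⟩
  | obs i t =>
    refine ⟨Function.update ρ₀ i t, i + 1, by lia, ?_⟩
    rw [pathNode_of_lt _ i.2]
    simp
  | term => exact absurd rfl hx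

lemma enabledActions_nonempty (x : Ω.Node) : (Ω.enabledActions x).Nonempty := by
  by_cases hx : x = .term
  · exact ⟨.term, Or.inr ⟨hx, rfl⟩⟩
  · obtain ⟨ρ, k, hk, rfl⟩ := exists_pathNode_eq x hx
    exact ⟨_, edge_pathNode ρ hk⟩

lemma eq_term_of_mem_enabledActions {y : Ω.Node} (h : y ∈ Ω.enabledActions .term) : y = .term := by
  rcases h with ⟨ρ, k, hk, h, -⟩ | h
  · exact absurd h.symm (pathNode_ne_term ρ hk)
  · exact h.2

lemma layer_of_mem_enabledActions {x y : Ω.Node} (h : y ∈ Ω.enabledActions x) (hy : y ≠ .term) :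
    y.layer = x.layer + 1 := by
  rcases h with ⟨ρ, k, hk, rfl, rfl⟩ | h
  · rw [layer_pathNode ρ (by lia), layer_pathNode ρ (by lia)]
  · exact absurd h.2 hy

lemma time_pathNode_le (ρ : Ω.Instance) {k : ℕ} (hk : k < n + 1) :
    (Ω.pathNode ρ k).time ≤ (Ω.pathNode ρ (k + 1)).time := by
  rw [pathNode_of_lt ρ hk]
  cases k with
  | zero => exact (Ω.pos _ _ (ρ _).2).le
  | succ k =>
    rw [pathNode_of_lt ρ (Nat.lt_of_succ_lt hk)]
    exact (Ω.ordered _ _ (by simp [Fin.lt_def]) _ (ρ _).2 _ (ρ _).2).le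

lemma time_le_of_mem_enabledActions {x y : Ω.Node} (h : y ∈ Ω.enabledActions x)
    (hy : y ≠ .term) : x.time ≤ y.time := by
  rcases h with ⟨ρ, k, hk, rfl, rfl⟩ | h
  · refine time_pathNode_le ρ (hk.lt_of_ne fun h => hy ?_)
    rw [h, pathNode_last]
  · exact absurd h.2 hy

lemma notMem_resetStates {M : CTMC S C} {s : S} {x : Ω.Node} (h : ∀ i t, x ≠ .obs i t) :
    (s, x) ∉ Ω.resetStates M := fun ⟨i, t, hx, _⟩ => h i t hx

end ImpreciseEvidence

/-! ## Transition functions of the abstraction -/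

namespace TimePartition

open ImpreciseEvidence

variable {S C : Type*} {n : ℕ} {Ω : ImpreciseEvidence C n} (Ψ : TimePartition Ω)

/-- The position of an abstract node on the paths of the abstracted evidence graph. -/
def AbsNode.layer {Ψ : TimePartition Ω} : Ψ.AbsNode → ℕ
  | .init => 0
  | .obs i _ => i + 1
  | .term => n + 2

lemma layer_abs (x : Ω.Node) : (Ψ.abs x).layer = x.layer := by
  cases x <;> rfl

lemma abs_eq_init {x : Ω.Node} : Ψ.abs x = .init ↔ x = .init := by
  cases x <;> simp [abs]

lemma abs_eq_term {x : Ω.Node} : Ψ.abs x = .term ↔ x = .term := by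
  cases x <;> simp [abs]

lemma abs_surjective : Function.Surjective Ψ.abs := by
  rintro (_ | ⟨i, _, t, rfl⟩ | _)
  · exact ⟨.init, rfl⟩
  · exact ⟨.obs i t, rfl⟩
  · exact ⟨.term, rfl⟩

/-- Abstract nodes remember the index of their observation. Hence memoryless choices along `ρ` never
conflict. -/
lemma abs_pathNode_injective (ρ : Ω.Instance) {k l : ℕ} (hk : k ≤ n + 2) (hl : l ≤ n + 2)
    (h : Ψ.abs (Ω.pathNode ρ k) = Ψ.abs (Ω.pathNode ρ l)) : k = l := by
  have := congrArg AbsNode.layer h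
  rwa [layer_abs, layer_abs, layer_pathNode ρ hk, layer_pathNode ρ hl] at this

instance : Finite Ψ.AbsNode := by
  let F : Unit ⊕ (Σ i, Set.range (Ψ.cell i)) ⊕ Unit → Ψ.AbsNode
    | .inl _ => .init
    | .inr (.inl p) => .obs p.1 p.2
    | .inr (.inr _) => .term
  refine Finite.of_surjective F ?_
  rintro (_ | ⟨i, j⟩ | _)
  · exact ⟨.inl (), rfl⟩
  · exact ⟨.inr (.inl ⟨i, j⟩), rfl⟩
  · exact ⟨.inr (.inr ()), rfl⟩

noncomputable instance : Fintype Ψ.AbsNode := Fintype.ofFinite _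

variable [Fintype S] (M : CTMC S C)

/-- The probabilities with which action `y` in `(s, x)` leads into the sets of states represented by
abstract states. -/
noncomputable def absTrans (s : S) (x y : Ω.Node) (q' : S × Ψ.AbsNode) : ℝ :=
  ∑ᶠ z ∈ {z | Ψ.abs z = q'.2}, Ω.condTrans M (s, x) y (q'.1, z)

/-- Used with the single time node that an action leads to, where the sum over a possibly infinite
fibre of `Ψ` collapses to one term. -/
lemma absTrans_eq_of_forall_ne {s : S} {x y z : Ω.Node} {q' : S × Ψ.AbsNode}
    [Decidable (q'.2 = Ψ.abs z)]
    (h : ∀ z', z' ≠ z → Ω.condTrans M (s, x) y (q'.1, z') = 0) :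
    Ψ.absTrans M s x y q' =
      if q'.2 = Ψ.abs z then Ω.condTrans M (s, x) y (q'.1, z) else 0 := by
  rw [absTrans, finsum_eq_single _ z]
  · by_cases hz : q'.2 = Ψ.abs z
    · simp [hz]
    · simp [hz, Ne.symm hz]
  · intro z' hz'
    simp [h z' hz']

open Classical in
lemma absTrans_of_mem_resetStates {s : S} {x : Ω.Node} (h : (s, x) ∈ Ω.resetStates M)
    (y : Ω.Node) (q' : S × Ψ.AbsNode) :
    Ψ.absTrans M s x y q' = if q' = (M.init, .init) then 1 else 0 := by
  have hc : ∀ z : S × Ω.Node, Ω.condTrans M (s, x) y z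
      = if z = (M.init, .init) then 1 else 0 := fun z => by rw [condTrans, if_pos h]
  rw [Ψ.absTrans_eq_of_forall_ne M (z := .init), hc]
  · obtain ⟨s', ψ⟩ := q'
    by_cases h1 : ψ = .init <;> by_cases h2 : s' = M.init <;> simp [h1, h2, abs]
  · intro z' hz'
    rw [hc, if_neg]
    exact fun h => hz' (congrArg Prod.snd h)

open Classical in
lemma absTrans_term {s : S} {x : Ω.Node} (h : (s, x) ∉ Ω.resetStates M) (q' : S × Ψ.AbsNode) :
    Ψ.absTrans M s x .term q' = if q' = (s, .term) then 1 else 0 := by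
  have hc : ∀ z : S × Ω.Node, Ω.condTrans M (s, x) .term z
      = if z.2 = .term then (if s = z.1 then 1 else 0) else 0 := fun z => by
    rw [condTrans, if_neg h, unfoldTrans, if_pos rfl]
  rw [Ψ.absTrans_eq_of_forall_ne M (z := .term), hc]
  · obtain ⟨s', ψ⟩ := q'
    by_cases h1 : ψ = .term <;> by_cases h2 : s = s' <;> simp [h1, h2, abs, Ne.symm]
  · intro z' hz'
    rw [hc, if_neg hz']

open Classical in
lemma absTrans_of_ne_term {s : S} {x y : Ω.Node} (h : (s, x) ∉ Ω.resetStates M)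
    (hy : y ≠ .term) (q' : S × Ψ.AbsNode) :
    Ψ.absTrans M s x y q' =
      if q'.2 = Ψ.abs y then M.transient (y.time - x.time) s q'.1 else 0 := by
  have hc : ∀ z : S × Ω.Node, Ω.condTrans M (s, x) y z
      = if z.2 = y then M.transient (y.time - x.time) s z.1 else 0 := fun z => by
    rw [condTrans, if_neg h, unfoldTrans, if_neg hy]
  rw [Ψ.absTrans_eq_of_forall_ne M (z := y), hc, if_pos rfl]
  intro z' hz'
  rw [hc, if_neg hz']

lemma absTrans_nonneg (s : S) {x y : Ω.Node} (hy : y ∈ Ω.enabledActions x) (q' : S × Ψ.AbsNode) :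
    0 ≤ Ψ.absTrans M s x y q' := by
  classical
  by_cases h : (s, x) ∈ Ω.resetStates M
  · rw [Ψ.absTrans_of_mem_resetStates M h]; split_ifs <;> norm_num
  · by_cases hyt : y = .term
    · rw [hyt, Ψ.absTrans_term M h]; split_ifs <;> norm_num
    · rw [Ψ.absTrans_of_ne_term M h hyt]
      split_ifs
      · exact M.transient_nonneg (sub_nonneg.2 (time_le_of_mem_enabledActions hy hyt)) _ _
      · exact le_rfl

lemma sum_absTrans (s : S) (x y : Ω.Node) : ∑ q', Ψ.absTrans M s x y q' = 1 := by
  classical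
  by_cases h : (s, x) ∈ Ω.resetStates M
  · simp_rw [Ψ.absTrans_of_mem_resetStates M h]
    simp
  · by_cases hyt : y = .term
    · simp_rw [hyt, Ψ.absTrans_term M h]
      simp
    · simp_rw [Ψ.absTrans_of_ne_term M h hyt]
      rw [Fintype.sum_prod_type]
      simp [M.sum_transient]

lemma absTrans_le_one (s : S) {x y : Ω.Node} (hy : y ∈ Ω.enabledActions x)
    (q' : S × Ψ.AbsNode) : Ψ.absTrans M s x y q' ≤ 1 :=
  (Finset.single_le_sum (fun q _ => Ψ.absTrans_nonneg M s hy q) (Finset.mem_univ q')).trans_eq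
    (Ψ.sum_absTrans M s x y)

/-- The distribution over abstract states for action `y` in `(s, x)`. -/
noncomputable def absPMF (s : S) {x y : Ω.Node} (hy : y ∈ Ω.enabledActions x) :
    PMF (S × Ψ.AbsNode) :=
  PMF.ofFintype (fun q' => ENNReal.ofReal (Ψ.absTrans M s x y q')) (by
    rw [← ENNReal.ofReal_sum_of_nonneg fun q' _ => Ψ.absTrans_nonneg M s hy q', sum_absTrans,
      ENNReal.ofReal_one])

lemma toReal_absPMF (s : S) {x y : Ω.Node} (hy : y ∈ Ω.enabledActions x) (q' : S × Ψ.AbsNode) :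
    (Ψ.absPMF M s hy q').toReal = Ψ.absTrans M s x y q' := by
  rw [absPMF, PMF.ofFintype_apply, ENNReal.toReal_ofReal (Ψ.absTrans_nonneg M s hy q')]

/-- The transition probabilities of the conditioned MDP that an interval of the abstraction has to
contain. -/
def absProbs (q : S × Ψ.AbsNode) (a : Ψ.AbsNode) (q' : S × Ψ.AbsNode) : Set ℝ :=
  {p | ∃ x y, Ψ.abs x = q.2 ∧ Ψ.abs y = a ∧ y ∈ Ω.enabledActions x ∧ p = Ψ.absTrans M q.1 x y q'}

/-- Real infima and suprema are informative only for bounded sets; here the bounds are `0` and `1`.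
-/
lemma absTrans_mem_interval (s : S) {x y : Ω.Node} (hy : y ∈ Ω.enabledActions x)
    (q' : S × Ψ.AbsNode) :
    Ψ.absTrans M s x y q' ∈ (Ψ.abstraction M).interval (s, Ψ.abs x) (Ψ.abs y) q' := by
  have hmem : Ψ.absTrans M s x y q' ∈ Ψ.absProbs M (s, Ψ.abs x) (Ψ.abs y) q' :=
    ⟨x, y, rfl, rfl, hy, rfl⟩
  refine ⟨csInf_le ⟨0, ?_⟩ hmem, le_csSup ⟨1, ?_⟩ hmem⟩
  · rintro _ ⟨x, y, -, -, hy, rfl⟩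
    exact Ψ.absTrans_nonneg M _ hy q'
  · rintro _ ⟨x, y, -, -, hy, rfl⟩
    exact Ψ.absTrans_le_one M _ hy q'

lemma sInf_absProbs_nonneg (q : S × Ψ.AbsNode) (a : Ψ.AbsNode) (q' : S × Ψ.AbsNode) :
    0 ≤ sInf (Ψ.absProbs M q a q') := by
  refine Real.sInf_nonneg ?_
  rintro _ ⟨x, y, -, -, hy, rfl⟩
  exact Ψ.absTrans_nonneg M _ hy q'

/-- Impossible moves of the conditioned MDP stay impossible for every admissible matrix, as their
interval is `[0, 0]`. -/
lemma eq_zero_of_mem_interval {q : S × Ψ.AbsNode} {a : Ψ.AbsNode} {q' : S × Ψ.AbsNode}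
    (h : ∀ x y, Ψ.abs x = q.2 → Ψ.abs y = a → y ∈ Ω.enabledActions x →
      Ψ.absTrans M q.1 x y q' = 0) {p : ℝ} (hp : p ∈ (Ψ.abstraction M).interval q a q') :
    p = 0 := by
  refine le_antisymm (hp.2.trans (Real.sSup_nonpos ?_))
    ((Ψ.sInf_absProbs_nonneg M q a q').trans hp.1)
  rintro _ ⟨x, y, h1, h2, hy, rfl⟩
  exact (h x y h1 h2 hy).le

lemma enabled_abstraction {x y : Ω.Node} (hy : y ∈ Ω.enabledActions x) (s : S) :
    Ψ.abs y ∈ (Ψ.abstraction M).enabled (s, Ψ.abs x) := ⟨x, y, rfl, rfl, hy⟩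

/-- For an instance `ρ`, there is a transition function of the abstraction that agrees with the
conditioned MDP along `ρ`. -/
lemma exists_trans_along (ρ : Ω.Instance) : ∃ P : (Ψ.abstraction M).Trans,
    ∀ (s : S), ∀ k ≤ n + 1, ∀ q',
      (P.1 (s, Ψ.abs (Ω.pathNode ρ k)) (Ψ.abs (Ω.pathNode ρ (k + 1))) q').toReal
        = Ψ.absTrans M s (Ω.pathNode ρ k) (Ω.pathNode ρ (k + 1)) q' := by
  have key : ∀ (q : S × Ψ.AbsNode) (a : Ψ.AbsNode), ∃ p : PMF (S × Ψ.AbsNode),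
      (a ∈ (Ψ.abstraction M).enabled q →
        ∀ q', (p q').toReal ∈ (Ψ.abstraction M).interval q a q') ∧
      ∀ k ≤ n + 1, q.2 = Ψ.abs (Ω.pathNode ρ k) → a = Ψ.abs (Ω.pathNode ρ (k + 1)) →
        ∀ q', (p q').toReal = Ψ.absTrans M q.1 (Ω.pathNode ρ k) (Ω.pathNode ρ (k + 1)) q' := by
    rintro ⟨s, ψ⟩ a
    by_cases h : ∃ k ≤ n + 1, ψ = Ψ.abs (Ω.pathNode ρ k) ∧ a = Ψ.abs (Ω.pathNode ρ (k + 1))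
    · obtain ⟨k, hk, rfl, rfl⟩ := h
      refine ⟨Ψ.absPMF M s (edge_pathNode ρ hk), fun _ q' => ?_, fun l hl h1 h2 q' => ?_⟩
      · rw [toReal_absPMF]
        exact Ψ.absTrans_mem_interval M s (edge_pathNode ρ hk) q'
      -- The prescribed row is unambiguous: the abstract node determines the position on `ρ`.
      · obtain rfl := Ψ.abs_pathNode_injective ρ (by lia) (by lia) h1
        rw [toReal_absPMF]
    · have hno : ∀ k ≤ n + 1, ψ = Ψ.abs (Ω.pathNode ρ k) → a = Ψ.abs (Ω.pathNode ρ (k + 1)) →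
          False := fun k hk h1 h2 => h ⟨k, hk, h1, h2⟩
      -- Off the path, an enabled action takes the row of any pair of nodes it represents; a
      -- disabled one is unconstrained.
      by_cases ha : a ∈ (Ψ.abstraction M).enabled (s, ψ)
      · obtain ⟨x, y, rfl, rfl, hy⟩ := ha
        refine ⟨Ψ.absPMF M s hy, fun _ q' => ?_, fun k hk h1 h2 => (hno k hk h1 h2).elim⟩
        rw [toReal_absPMF]
        exact Ψ.absTrans_mem_interval M s hy q'
      · exact ⟨PMF.pure (s, ψ), fun h => absurd h ha, fun k hk h1 h2 => (hno k hk h1 h2).elim⟩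
  choose P hP hP' using key
  exact ⟨⟨P, fun q a ha => hP q a ha⟩, fun s k hk => hP' _ _ k hk rfl rfl⟩

lemma enabled_nonempty (q : S × Ψ.AbsNode) : ((Ψ.abstraction M).enabled q).Nonempty := by
  obtain ⟨s, ψ⟩ := q
  obtain ⟨x, rfl⟩ := Ψ.abs_surjective ψ
  obtain ⟨y, hy⟩ := enabledActions_nonempty x
  exact ⟨_, Ψ.enabled_abstraction M hy s⟩

lemma exists_sched_along (ρ : Ω.Instance) : ∃ σ : (Ψ.abstraction M).Sched, ∀ s : S, ∀ k ≤ n + 1,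
    σ.1 (s, Ψ.abs (Ω.pathNode ρ k)) = Ψ.abs (Ω.pathNode ρ (k + 1)) := by
  have key : ∀ q : S × Ψ.AbsNode, ∃ a ∈ (Ψ.abstraction M).enabled q,
      ∀ k ≤ n + 1, q.2 = Ψ.abs (Ω.pathNode ρ k) → a = Ψ.abs (Ω.pathNode ρ (k + 1)) := by
    rintro ⟨s, ψ⟩
    by_cases h : ∃ k ≤ n + 1, ψ = Ψ.abs (Ω.pathNode ρ k)
    · obtain ⟨k, hk, rfl⟩ := h
      refine ⟨_, Ψ.enabled_abstraction M (edge_pathNode ρ hk) s, fun l hl h => ?_⟩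
      rw [Ψ.abs_pathNode_injective ρ (by lia) (by lia) h]
    · obtain ⟨a, ha⟩ := Ψ.enabled_nonempty M (s, ψ)
      exact ⟨a, ha, fun k hk h' => absurd ⟨k, hk, h'⟩ h⟩
  choose σ hσ hσ' using key
  exact ⟨⟨σ, hσ⟩, fun s k hk => hσ' _ k hk rfl⟩

end TimePartition

/-! ### Single passes through the abstraction and attainment of the optima. -/

namespace TimePartition

open ImpreciseEvidence

variable {S C : Type*} {n : ℕ} {Ω : ImpreciseEvidence C n} (Ψ : TimePartition Ω)

/-- The terminal states of the abstraction. -/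
def termStates (S : Type*) : Set (S × Ψ.AbsNode) := {q | q.2 = .term}

/-- The initial state and the terminal states, where a pass through the observations ends. -/
def stopStates (M : CTMC S C) : Set (S × Ψ.AbsNode) :=
  insert (M.init, .init) (Ψ.termStates S)

/-- The number of steps to the terminal layer. -/
def stepsToGo (q : S × Ψ.AbsNode) : ℕ := n + 2 - q.2.layer

/-- The terminal reward for the states in `U`. -/
noncomputable def termReward (U : Set S) : S × Ψ.AbsNode → ℝ :=
  ({q | q.2 = .term ∧ q.1 ∈ U} : Set (S × Ψ.AbsNode)).indicator 1

lemma termReward_nonneg (U : Set S) (q : S × Ψ.AbsNode) : 0 ≤ Ψ.termReward U q :=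
  Set.indicator_nonneg (fun _ _ => zero_le_one) q

lemma termReward_le_univ (U : Set S) (q : S × Ψ.AbsNode) :
    Ψ.termReward U q ≤ Ψ.termReward Set.univ q :=
  Set.indicator_le_indicator_of_subset
    (show {q : S × Ψ.AbsNode | q.2 = .term ∧ q.1 ∈ U} ⊆ {q | q.2 = .term ∧ q.1 ∈ Set.univ}
      from fun _ hq => ⟨hq.1, trivial⟩) (fun _ => zero_le_one) q

variable {Ψ} in
lemma AbsNode.layer_le (ψ : Ψ.AbsNode) : ψ.layer ≤ n + 2 := by
  rcases ψ with _ | ⟨i, _⟩ | _ <;> simp only [AbsNode.layer] <;> lia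

variable [Fintype S] (M : CTMC S C)

/-- The transition matrix of the Markov chain induced by a transition function and a scheduler. -/
noncomputable def inducedMatrix (P : (Ψ.abstraction M).Trans) (σ : (Ψ.abstraction M).Sched)
    (q q' : S × Ψ.AbsNode) : ℝ := (P.1 q (σ.1 q) q').toReal

-- Each move enters a stopping state or the next layer. Stating this for every matrix within the
-- intervals makes it available on the whole polytope.
variable {M} in
lemma isLayered_of_mem_interval (σ : (Ψ.abstraction M).Sched) {K : S × Ψ.AbsNode → S × Ψ.AbsNode → ℝ}
    (hK : ∀ q q', K q q' ∈ (Ψ.abstraction M).interval q (σ.1 q) q') :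
    IsLayered K (Ψ.stopStates M) Ψ.stepsToGo := by
  classical
  intro q q' hq' hle
  refine Ψ.eq_zero_of_mem_interval M (fun x y hx hy hxy => ?_) (hK q q')
  by_cases h : (q.1, x) ∈ Ω.resetStates M
  · rw [Ψ.absTrans_of_mem_resetStates M h, if_neg]
    exact fun h => hq' (Or.inl h)
  · by_cases hyt : y = .term
    · rw [hyt, Ψ.absTrans_term M h, if_neg]
      exact fun h => hq' (Or.inr (congrArg Prod.snd h))
    · rw [Ψ.absTrans_of_ne_term M h hyt, if_neg]
      intro h'
      have h1 := layer_of_mem_enabledActions hxy hyt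
      have h2 := q'.2.layer_le
      rw [← Ψ.layer_abs, ← Ψ.layer_abs, hx, ← h'] at h1
      simp only [stepsToGo] at hle
      lia

-- All intervals to other states are `[0, 0]`, so the total mass `1` stays put.
variable {M} in
lemma eq_pure_of_mem_termStates (P : (Ψ.abstraction M).Trans) (σ : (Ψ.abstraction M).Sched)
    {q : S × Ψ.AbsNode} (hq : q ∈ Ψ.termStates S) : P.1 q (σ.1 q) = PMF.pure q := by
  classical
  obtain ⟨s, ψ⟩ := q
  obtain rfl : ψ = .term := hq
  have hzero : ∀ q', q' ≠ (s, .term) → P.1 (s, .term) (σ.1 (s, .term)) q' = 0 := by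
    intro q' hq'
    have h0 := Ψ.eq_zero_of_mem_interval M (fun x y hx hy hxy => ?_)
      (P.2 (s, .term) _ (σ.2 (s, .term)) q')
    · rcases (ENNReal.toReal_eq_zero_iff _).1 h0 with h | h
      · exact h
      · exact absurd h (PMF.apply_ne_top _ _)
    · obtain rfl := Ψ.abs_eq_term.1 hx
      obtain rfl := eq_term_of_mem_enabledActions hxy
      rw [Ψ.absTrans_term M (notMem_resetStates (by intro _ _ h; cases h)), if_neg hq']
  have hone := PMF.sum_coe_fintype (P.1 (s, .term) (σ.1 (s, .term)))
  rw [Finset.sum_eq_single _ (fun q' _ => hzero q') (by simp)] at hone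
  ext q'
  rw [PMF.pure_apply]
  split_ifs with h
  · rw [h, hone]
  · exact hzero q' h

lemma hitVal_inducedMatrix_one (P : (Ψ.abstraction M).Trans) (σ : (Ψ.abstraction M).Sched)
    (q : S × Ψ.AbsNode) :
    hitVal (Ψ.inducedMatrix M P σ) (Ψ.stopStates M) (fun _ => 1) (n + 3) q = 1 := by
  refine (Ψ.isLayered_of_mem_interval σ fun q q' => P.2 q _ (σ.2 q) q').hitVal_one
    (fun q => ?_) _ _ (by simp only [stepsToGo]; lia)
  rw [← ENNReal.toReal_sum fun a _ => PMF.apply_ne_top _ _, PMF.sum_coe_fintype,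
    ENNReal.toReal_one]

/-- The renewal formula applied to passes from the initial state; `n + 3` steps suffice because
`stepsToGo` is at most `n + 2`. -/
lemma reach_abstraction (P : (Ψ.abstraction M).Trans) (σ : (Ψ.abstraction M).Sched) (s : S) :
    (Ψ.abstraction M).reach P σ (s, .term) = ENNReal.ofReal
      (hitVal (Ψ.inducedMatrix M P σ) (Ψ.stopStates M) (Ψ.termReward {s}) (n + 3)
          (M.init, .init) /
        hitVal (Ψ.inducedMatrix M P σ) (Ψ.stopStates M) (Ψ.termReward Set.univ) (n + 3)
          (M.init, .init)) := by
  classical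
  have h := reachProb_eq_div (fun q => P.1 q (σ.1 q)) (M.init, .init) (Ψ.termStates S)
    (fun h => nomatch (show AbsNode.init = AbsNode.term from h))
    (fun q hq => Ψ.eq_pure_of_mem_termStates P σ hq) (n + 3)
    (Ψ.hitVal_inducedMatrix_one M P σ) (z := (s, .term)) rfl
  have e1 : (Pi.single (s, .term) 1 : S × Ψ.AbsNode → ℝ) = Ψ.termReward {s} := by
    ext ⟨s', ψ⟩
    by_cases h1 : s' = s <;> by_cases h2 : ψ = .term <;>
      simp [termReward, Set.indicator, h1, h2]
  have e2 : (Ψ.termStates S).indicator 1 = Ψ.termReward (Set.univ : Set S) := by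
    simp [termReward, termStates]
  rw [e1, e2] at h
  exact h

lemma inducedMatrix_nonneg (P : (Ψ.abstraction M).Trans) (σ : (Ψ.abstraction M).Sched)
    (q q' : S × Ψ.AbsNode) : 0 ≤ Ψ.inducedMatrix M P σ q q' := ENNReal.toReal_nonneg

/-- The terminal reward given by the weights. -/
noncomputable def weightReward (w : S → ℝ≥0) (q : S × Ψ.AbsNode) : ℝ :=
  ∑ s, (w s : ℝ) * Ψ.termReward {s} q

/-- All states share the same denominator, so linearity in the reward gives one linear-fractional
quotient to optimize. -/
lemma value_eq_ofReal (w : S → ℝ≥0) (P : (Ψ.abstraction M).Trans)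
    (σ : (Ψ.abstraction M).Sched) :
    Ψ.value M w P σ = ENNReal.ofReal
      (hitVal (Ψ.inducedMatrix M P σ) (Ψ.stopStates M) (Ψ.weightReward w) (n + 3)
          (M.init, .init) /
        hitVal (Ψ.inducedMatrix M P σ) (Ψ.stopStates M) (Ψ.termReward Set.univ) (n + 3)
          (M.init, .init)) := by
  have hnn : ∀ U : Set S, 0 ≤ hitVal (Ψ.inducedMatrix M P σ) (Ψ.stopStates M) (Ψ.termReward U)
      (n + 3) (M.init, .init) := fun U =>
    hitVal_nonneg (Ψ.inducedMatrix_nonneg M P σ) (fun q _ => Ψ.termReward_nonneg U q) _ _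
  unfold weightReward
  rw [hitVal_sum, Finset.sum_div, ENNReal.ofReal_sum_of_nonneg]
  · refine Finset.sum_congr rfl fun s _ => ?_
    rw [reach_abstraction, hitVal_const_mul, mul_div_assoc, ENNReal.ofReal_mul (NNReal.coe_nonneg _),
      ENNReal.ofReal_coe_nnreal, mul_comm]
  · intro s _
    rw [hitVal_const_mul]
    exact div_nonneg (mul_nonneg (NNReal.coe_nonneg _) (hnn _)) (hnn _)

/-- Ensures that the numerator vanishes wherever the denominator does. -/
lemma abs_weightReward_le (w : S → ℝ≥0) (q : S × Ψ.AbsNode) :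
    |Ψ.weightReward w q| ≤ (∑ s, (w s : ℝ)) * Ψ.termReward Set.univ q := by
  rw [weightReward, abs_of_nonneg (Finset.sum_nonneg fun s _ =>
    mul_nonneg (NNReal.coe_nonneg _) (Ψ.termReward_nonneg _ q)), Finset.sum_mul]
  exact Finset.sum_le_sum fun s _ =>
    mul_le_mul_of_nonneg_left (Ψ.termReward_le_univ _ q) (NNReal.coe_nonneg _)

/-- Rows within the intervals are the rows of some transition function. -/
lemma exists_trans_inducedMatrix_eq (σ : (Ψ.abstraction M).Sched)
    {K : S × Ψ.AbsNode → S × Ψ.AbsNode → ℝ}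
    (hK : ∀ q, K q ∈ massBox (fun q' => sInf (Ψ.absProbs M q (σ.1 q) q'))
      (fun q' => sSup (Ψ.absProbs M q (σ.1 q) q'))) :
    ∃ P : (Ψ.abstraction M).Trans, Ψ.inducedMatrix M P σ = K := by
  classical
  obtain ⟨ρ⟩ := Ω.nonempty_instance
  obtain ⟨P₀, -⟩ := Ψ.exists_trans_along M ρ
  have hnn : ∀ q q', 0 ≤ K q q' := fun q q' =>
    (Ψ.sInf_absProbs_nonneg M _ _ _).trans ((hK q).1 q').1
  let row : S × Ψ.AbsNode → PMF (S × Ψ.AbsNode) := fun q =>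
    PMF.ofFintype (fun q' => ENNReal.ofReal (K q q')) (by
      rw [← ENNReal.ofReal_sum_of_nonneg fun q' _ => hnn q q', (hK q).2, ENNReal.ofReal_one])
  have hrow : ∀ q q', (row q q').toReal = K q q' := fun q q' => by
    rw [PMF.ofFintype_apply, ENNReal.toReal_ofReal (hnn q q')]
  -- Only the rows chosen by `σ` are prescribed; `P₀` supplies admissible rows for the other
  -- actions.
  refine ⟨⟨fun q a => if a = σ.1 q then row q else P₀.1 q a, fun q a ha q' => ?_⟩, ?_⟩
  · dsimp only
    split_ifs with h
    · rw [hrow, h]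
      exact (hK q).1 q'
    · exact P₀.2 q a ha q'
  · ext q q'
    simp only [inducedMatrix, if_true, hrow]

lemma inducedMatrix_mem_massBox (P : (Ψ.abstraction M).Trans) (σ : (Ψ.abstraction M).Sched)
    (q : S × Ψ.AbsNode) :
    Ψ.inducedMatrix M P σ q ∈ massBox (fun q' => sInf (Ψ.absProbs M q (σ.1 q) q'))
      (fun q' => sSup (Ψ.absProbs M q (σ.1 q) q')) := by
  refine ⟨fun q' => P.2 q _ (σ.2 q) q', ?_⟩
  simp only [inducedMatrix]
  rw [← ENNReal.toReal_sum fun a _ => PMF.apply_ne_top _ _, PMF.sum_coe_fintype,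
    ENNReal.toReal_one]

lemma exists_isGreatest_value (w : S → ℝ≥0) (σ : (Ψ.abstraction M).Sched) :
    ∃ v, IsGreatest (Set.range fun P => Ψ.value M w P σ) v := by
  obtain ⟨ρ⟩ := Ω.nonempty_instance
  obtain ⟨P₀, -⟩ := Ψ.exists_trans_along M ρ
  obtain ⟨K, hK, hmax⟩ := exists_forall_hitVal_div_le (B := Ψ.stopStates M)
    (ℓ := Ψ.stepsToGo) (f := Ψ.weightReward w) (g := Ψ.termReward Set.univ)
    (fun q q' => Ψ.sInf_absProbs_nonneg M q (σ.1 q) q')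
    (fun K hK => Ψ.isLayered_of_mem_interval σ fun q q' => (hK q).1 q')
    (fun q => ⟨_, Ψ.inducedMatrix_mem_massBox M P₀ σ q⟩) (fun q _ => Ψ.termReward_nonneg _ q)
    (∑ s, (w s : ℝ)) (fun q _ => Ψ.abs_weightReward_le w q) (n + 3) (M.init, .init)
  obtain ⟨P, rfl⟩ := Ψ.exists_trans_inducedMatrix_eq M σ hK
  refine ⟨_, ⟨P, rfl⟩, ?_⟩
  rintro _ ⟨P', rfl⟩
  simp only [value_eq_ofReal]
  exact ENNReal.ofReal_le_ofReal (hmax _ (Ψ.inducedMatrix_mem_massBox M P' σ))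

lemma exists_isLeast_value (w : S → ℝ≥0) (σ : (Ψ.abstraction M).Sched) :
    ∃ v, IsLeast (Set.range fun P => Ψ.value M w P σ) v := by
  obtain ⟨ρ⟩ := Ω.nonempty_instance
  obtain ⟨P₀, -⟩ := Ψ.exists_trans_along M ρ
  obtain ⟨K, hK, hmin⟩ := exists_forall_le_hitVal_div (B := Ψ.stopStates M)
    (ℓ := Ψ.stepsToGo) (f := Ψ.weightReward w) (g := Ψ.termReward Set.univ)
    (fun q q' => Ψ.sInf_absProbs_nonneg M q (σ.1 q) q')
    (fun K hK => Ψ.isLayered_of_mem_interval σ fun q q' => (hK q).1 q')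
    (fun q => ⟨_, Ψ.inducedMatrix_mem_massBox M P₀ σ q⟩) (fun q _ => Ψ.termReward_nonneg _ q)
    (∑ s, (w s : ℝ)) (fun q _ => Ψ.abs_weightReward_le w q) (n + 3) (M.init, .init)
  obtain ⟨P, rfl⟩ := Ψ.exists_trans_inducedMatrix_eq M σ hK
  refine ⟨_, ⟨P, rfl⟩, ?_⟩
  rintro _ ⟨P', rfl⟩
  simp only [value_eq_ofReal]
  exact ENNReal.ofReal_le_ofReal (hmin _ (Ψ.inducedMatrix_mem_massBox M P' σ))

/-! ## Precise instances -/

/-- The states that agree with the `k`-th observation, and lie in `U` for the last one. -/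
def agreeStates (M : CTMC S C) (ρ : Ω.Instance) (U : Set S) (k : ℕ) : Set S :=
  {s | (s, Ω.pathNode ρ k) ∉ Ω.resetStates M ∧ (k = n + 1 → s ∈ U)}

-- Here `m` counts the observations still to come, one more step leads to the terminal layer, and
-- `j` counts spare steps. Unrolling a pass gives the recursion of `waitProb`.
open Classical in
lemma hitVal_along (ρ : Ω.Instance) {P : (Ψ.abstraction M).Trans} {σ : (Ψ.abstraction M).Sched}
    (hσ : ∀ s : S, ∀ k ≤ n + 1,
      σ.1 (s, Ψ.abs (Ω.pathNode ρ k)) = Ψ.abs (Ω.pathNode ρ (k + 1)))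
    (hP : ∀ (s : S), ∀ k ≤ n + 1, ∀ q',
      (P.1 (s, Ψ.abs (Ω.pathNode ρ k)) (Ψ.abs (Ω.pathNode ρ (k + 1))) q').toReal
        = Ψ.absTrans M s (Ω.pathNode ρ k) (Ω.pathNode ρ (k + 1)) q')
    (U : Set S) (m k j : ℕ) (hk : k + m = n + 1) (s : S) :
    hitVal (Ψ.inducedMatrix M P σ) (Ψ.stopStates M) (Ψ.termReward U) (m + 1 + j)
        (s, Ψ.abs (Ω.pathNode ρ k)) =
      if s ∈ agreeStates M ρ U k then M.waitProb
        (fun k => |(Ω.pathNode ρ (k + 1)).time - (Ω.pathNode ρ k).time|)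
        (agreeStates M ρ U) m k s else 0 := by
  have hstep : ∀ m k j, k ≤ n + 1 → ∀ s, hitVal (Ψ.inducedMatrix M P σ) (Ψ.stopStates M)
      (Ψ.termReward U) (m + 1 + j) (s, Ψ.abs (Ω.pathNode ρ k)) =
      ∑ q', Ψ.absTrans M s (Ω.pathNode ρ k) (Ω.pathNode ρ (k + 1)) q' *
        if q' ∈ Ψ.stopStates M then Ψ.termReward U q' else
          hitVal (Ψ.inducedMatrix M P σ) (Ψ.stopStates M) (Ψ.termReward U) (m + j) q' := by
    intro m k j hk s
    rw [show m + 1 + j = (m + j) + 1 by ring, hitVal]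
    refine Finset.sum_congr rfl fun q' _ => ?_
    rw [inducedMatrix, hσ s k hk, hP s k hk]
  -- A violated observation sends the pass to the initial state, where it stops with reward `0`.
  have hreset : ∀ m k j, k ≤ n + 1 → ∀ s, (s, Ω.pathNode ρ k) ∈ Ω.resetStates M →
      hitVal (Ψ.inducedMatrix M P σ) (Ψ.stopStates M)
      (Ψ.termReward U) (m + 1 + j) (s, Ψ.abs (Ω.pathNode ρ k)) = 0 := by
    intro m k j hk s hs
    rw [hstep m k j hk s]
    refine Finset.sum_eq_zero fun q' _ => ?_
    rw [Ψ.absTrans_of_mem_resetStates M hs]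
    split_ifs with h1 h2
    · subst h1; simp [termReward]
    · exact absurd (Or.inl h1) h2
    · exact zero_mul _
    · exact zero_mul _
  induction m generalizing k j s with
  | zero =>
    obtain rfl : k = n + 1 := hk
    by_cases hs : (s, Ω.pathNode ρ (n + 1)) ∈ Ω.resetStates M
    · rw [hreset 0 (n + 1) j le_rfl s hs, if_neg fun h => h.1 hs]
    · rw [hstep 0 (n + 1) j le_rfl s, pathNode_last]
      simp_rw [Ψ.absTrans_term M hs]
      rw [Finset.sum_eq_single (s, .term)]
      · have hmem : ((s, .term) : S × Ψ.AbsNode) ∈ Ψ.stopStates M := Or.inr rfl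
        rw [if_pos rfl, if_pos hmem, one_mul]
        by_cases hU : s ∈ U
        · rw [if_pos ⟨hs, fun _ => hU⟩]
          simp [termReward, hU, CTMC.waitProb]
        · rw [if_neg fun h => hU (h.2 rfl)]
          simp [termReward, hU]
      · intro q' _ hq'
        rw [if_neg hq', zero_mul]
      · simp
  | succ m ih =>
    have hk' : k ≤ n + 1 := by lia
    by_cases hs : (s, Ω.pathNode ρ k) ∈ Ω.resetStates M
    · rw [hreset (m + 1) k j hk' s hs, if_neg fun h => h.1 hs]
    · have hkn : k < n + 1 := by lia
      have hne : Ω.pathNode ρ (k + 1) ≠ .term := pathNode_ne_term ρ (by lia)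
      rw [hstep (m + 1) k j hk' s, if_pos ⟨hs, fun h => absurd h hkn.ne⟩, CTMC.waitProb,
        Fintype.sum_prod_type]
      refine Finset.sum_congr rfl fun a _ => ?_
      rw [Finset.sum_eq_single (Ψ.abs (Ω.pathNode ρ (k + 1)))]
      · have hmem : (a, Ψ.abs (Ω.pathNode ρ (k + 1))) ∉ Ψ.stopStates M := by
          rintro (h | h)
          · have := Ψ.abs_eq_init.1 (congrArg Prod.snd h)
            rw [pathNode_of_lt ρ hkn] at this
            exact nomatch this
          · exact hne (Ψ.abs_eq_term.1 h)
        rw [Ψ.absTrans_of_ne_term M hs hne, if_pos rfl, if_neg hmem, ih (k + 1) j (by lia) a,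
          abs_of_nonneg (sub_nonneg.2 (time_pathNode_le ρ hkn))]
      · intro ψ _ hψ
        rw [Ψ.absTrans_of_ne_term M hs hne, if_neg hψ, zero_mul]
      · simp

variable [MeasurableSpace S] [DiscreteMeasurableSpace S]

/-- Along an instance `ρ`, a pass through the abstraction ends in `U` with the probability of
observing `ρ` and being in `U` at the last observation. -/
lemma ofReal_hitVal_along (ρ : Ω.Instance) {P : (Ψ.abstraction M).Trans}
    {σ : (Ψ.abstraction M).Sched}
    (hσ : ∀ s : S, ∀ k ≤ n + 1,
      σ.1 (s, Ψ.abs (Ω.pathNode ρ k)) = Ψ.abs (Ω.pathNode ρ (k + 1)))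
    (hP : ∀ (s : S), ∀ k ≤ n + 1, ∀ q',
      (P.1 (s, Ψ.abs (Ω.pathNode ρ k)) (Ψ.abs (Ω.pathNode ρ (k + 1))) q').toReal
        = Ψ.absTrans M s (Ω.pathNode ρ k) (Ω.pathNode ρ (k + 1)) q')
    (U : Set S) :
    ENNReal.ofReal (hitVal (Ψ.inducedMatrix M P σ) (Ψ.stopStates M) (Ψ.termReward U) (n + 3)
        (M.init, .init)) =
      M.pathMeasure ({π | CTMC.stateAt π (ρ (Fin.last n)) ∈ U} ∩ Ω.consistentPaths M ρ) := by
  classical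
  -- A complete pass takes `n + 2` steps, so `j = 1` accounts for the bound `n + 3`.
  have h := Ψ.hitVal_along M ρ hσ hP U (n + 1) 0 1 (by lia) M.init
  have h0 : M.init ∈ agreeStates M ρ U 0 :=
    ⟨notMem_resetStates (by intro _ _ h; cases h), fun h => absurd h (by lia)⟩
  rw [if_pos h0] at h
  have hlaw := M.pathsFrom_stateAt (fun k => (Ω.pathNode ρ k).time) (agreeStates M ρ U) (n + 1)
    rfl (fun k hk => time_pathNode_le ρ hk) M.init
  change ENNReal.ofReal (hitVal _ _ _ (n + 1 + 1 + 1) (M.init, Ψ.abs (Ω.pathNode ρ 0))) = _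
  rw [h, ← hlaw]
  change M.pathMeasure _ = _
  congr 1
  have hnode : ∀ (i : ℕ) (hi : i < n + 1) (s : S),
      (s, Ω.pathNode ρ (i + 1)) ∉ Ω.resetStates M ↔ M.label s = Ω.label ⟨i, hi⟩ := by
    intro i hi s
    rw [pathNode_of_lt ρ hi, ← not_iff_not, not_not]
    constructor
    · rintro ⟨i', t', h1, h2⟩
      cases h1
      exact h2
    · exact fun h => ⟨_, _, rfl, h⟩
  ext π
  constructor
  · intro hπ
    have hall : ∀ i : Fin (n + 1), CTMC.stateAt π (ρ i) ∈ agreeStates M ρ U (i + 1) := by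
      intro i
      have := hπ (i + 1) (by lia) (by lia)
      rwa [pathNode_of_lt ρ i.2] at this
    exact ⟨(hall (Fin.last n)).2 rfl, fun i => (hnode i i.2 _).1 (hall i).1⟩
  · rintro ⟨h1, h2⟩ i hi hin
    obtain ⟨i, rfl⟩ : ∃ l, i = l + 1 := ⟨i - 1, by lia⟩
    have hi' : i < n + 1 := by lia
    change CTMC.stateAt π (Ω.pathNode ρ (i + 1)).time ∈ _
    refine ⟨(hnode i hi' _).2 ?_, fun hl => ?_⟩
    · rw [pathNode_of_lt ρ hi']
      exact h2 ⟨i, hi'⟩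
    · obtain rfl : i = n := by lia
      rw [pathNode_of_lt ρ hi']
      exact h1

/-- Every consistent scheduler attains the value of its instance under some transition function. -/
lemma exists_value_eq (w : S → ℝ≥0) (ρ : Ω.Instance) {σ : (Ψ.abstraction M).Sched}
    (hσ : ∀ s : S, ∀ k ≤ n + 1,
      σ.1 (s, Ψ.abs (Ω.pathNode ρ k)) = Ψ.abs (Ω.pathNode ρ (k + 1))) :
    ∃ P, Ψ.value M w P σ = ∑ s, Ω.condProb M ρ s * w s := by
  obtain ⟨P, hP⟩ := Ψ.exists_trans_along M ρ
  refine ⟨P, Finset.sum_congr rfl fun s _ => ?_⟩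
  congr 1
  have hs := Ψ.ofReal_hitVal_along M ρ hσ hP {s}
  have hu := Ψ.ofReal_hitVal_along M ρ hσ hP Set.univ
  have huniv : {π | CTMC.stateAt π (ρ (Fin.last n)) ∈ (Set.univ : Set S)} ∩ Ω.consistentPaths M ρ
      = Ω.consistentPaths M ρ := by
    ext π; simp
  rw [huniv] at hu
  rw [reach_abstraction, condProb, ← hu]
  change _ = M.pathMeasure ({π | CTMC.stateAt π (ρ (Fin.last n)) ∈ ({s} : Set S)} ∩ _) / _
  rw [← hs]
  have hle : hitVal (Ψ.inducedMatrix M P σ) (Ψ.stopStates M) (Ψ.termReward {s}) (n + 3)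
      (M.init, .init) ≤ hitVal (Ψ.inducedMatrix M P σ) (Ψ.stopStates M)
      (Ψ.termReward Set.univ) (n + 3) (M.init, .init) :=
    hitVal_mono (Ψ.inducedMatrix_nonneg M P σ) (fun q _ => Ψ.termReward_le_univ {s} q) _ _
  have h0 := hitVal_nonneg (B := Ψ.stopStates M) (Ψ.inducedMatrix_nonneg M P σ)
    (fun q _ => Ψ.termReward_nonneg {s} q) (n + 3) (M.init, .init)
  -- Evidence of probability zero is treated separately: both the real and the extended quotient are
  -- then `0 / 0 = 0`.
  rcases (h0.trans hle).eq_or_lt with h | h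
  · rw [← h] at hle ⊢
    rw [le_antisymm hle h0]
    simp
  · exact ENNReal.ofReal_div_of_pos h

end TimePartition

/-! ### The bounds on the weighted conditional reachability. -/

theorem mainTheorem4 {S C : Type*} [Fintype S] [MeasurableSpace S] [DiscreteMeasurableSpace S]
    (M : CTMC S C) (w : S → ℝ≥0) {n : ℕ} (Ω : ImpreciseEvidence C n) (Ψ : TimePartition Ω) :
    ∃ vmax vmin : (Ψ.abstraction M).Sched → ℝ≥0∞,
      (∀ σ, IsGreatest (Set.range fun P => Ψ.value M w P σ) (vmax σ)) ∧
      (∀ σ, IsLeast (Set.range fun P => Ψ.value M w P σ) (vmin σ)) ∧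
      (∃ mcon mall : ℝ≥0∞,
        IsGreatest (vmax '' {σ | Ψ.Consistent M σ}) mcon ∧
        IsGreatest (Set.range vmax) mall ∧
        Ω.weightedReach M w ≤ mcon ∧ mcon ≤ mall) ∧
      (∀ σ, Ψ.Consistent M σ → vmin σ ≤ Ω.weightedReach M w) := by
  choose vmax hmax using Ψ.exists_isGreatest_value M w
  choose vmin hmin using Ψ.exists_isLeast_value M w
  have hfin : Finite (Ψ.abstraction M).Sched :=
    inferInstanceAs (Finite {σ : S × Ψ.AbsNode → Ψ.AbsNode //
      ∀ q, σ q ∈ (Ψ.abstraction M).enabled q})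
  obtain ⟨ρ₀⟩ := Ω.nonempty_instance
  obtain ⟨σ₀, hσ₀⟩ := Ψ.exists_sched_along M ρ₀
  obtain ⟨σc, hc, hcmax⟩ := Set.exists_max_image {σ | Ψ.Consistent M σ} vmax (Set.toFinite _)
    ⟨σ₀, ρ₀, hσ₀⟩
  obtain ⟨σa, -, hamax⟩ := Set.exists_max_image Set.univ vmax (Set.toFinite _) ⟨σ₀, trivial⟩
  refine ⟨vmax, vmin, hmax, hmin, ⟨vmax σc, vmax σa, ⟨⟨σc, hc, rfl⟩, ?_⟩, ⟨⟨σa, rfl⟩, ?_⟩, ?_,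
    hamax σc trivial⟩, ?_⟩
  · rintro _ ⟨σ, hσ, rfl⟩
    exact hcmax σ hσ
  · rintro _ ⟨σ, rfl⟩
    exact hamax σ trivial
  · refine iSup_le fun ρ => ?_
    obtain ⟨σ, hσ⟩ := Ψ.exists_sched_along M ρ
    obtain ⟨P, hP⟩ := Ψ.exists_value_eq M w ρ hσ
    rw [← hP]
    exact ((hmax σ).2 ⟨P, rfl⟩).trans (hcmax σ ⟨ρ, hσ⟩)
  · rintro σ ⟨ρ, hσ⟩
    obtain ⟨P, hP⟩ := Ψ.exists_value_eq M w ρ hσ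
    refine ((hmin σ).2 ⟨P, rfl⟩).trans ?_
    change Ψ.value M w P σ ≤ _
    rw [hP]
    exact le_iSup (fun ρ : Ω.Instance => ∑ s, Ω.condProb M ρ s * (w s : ℝ≥0∞)) ρ
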